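/- **Blocks.** A coefficient function is a sequence $\mu=(\mu_1,\mu_2,\dots)$ of non-negative integers. Let $L=(e_1,\dots,e_N)$ be a list of non-negative integers with $N\ge 2$ and $e_1\neq 0$, and extend it to a periodic sequence by $e_{k+N}=e_k$. Let $\mathrm{rev}_n(\mu)=(\mu_n,\dots,\mu_1,0,0,\dots)$. For $t\ge 1$ let $\theta^{t}=\mathrm{rev}_t(e_1,e_2,\dots)$; this is the maximal $L$-block at index $t$, with support interval $[1,t]$. A proper $L$-block at index $t$ with support interval $[k,t]$, $1\le k\le t$, is a coefficient function $\zeta$ with $\zeta_j=\theta^t_j$ for $j>k$, $\zeta_k<\theta^t_k$, and $\zeta_j=0$ for $j<k$. The periodic Zeckendorf collection $\mathcal E$ for positive integers determined by $L$ is the set of sums of finitely many $L$-blocks (proper or maximal) with pairwise disjoint support intervals. For $n\ge 1$ let $\bar\beta^n$ be the coefficient function with $\bar\beta^n_k=0$ for $k<n$ and $\bar\beta^n_k=e_{k-n+1}$ for $k\ge n$. A proper $L^*$-block with support interval $[n,k]$, $1\le n\le k$, is a coefficient function $\zeta$ with $\zeta_j=\bar\beta^n_j$ for $j<k$, $\zeta_k<\bar\beta^n_k$,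 and $\zeta_j=0$ for $j>k$. The periodic Zeckendorf collection $\mathcal E^*$ for $(0,1)$ determined by $L$ is the set of non-zero finite or infinite sums of proper $L^*$-blocks with pairwise disjoint support intervals. Let $\overline{\mathcal E^*}$ be the union of $\mathcal E^*$ and the set of all $\zeta^1+\dots+\zeta^\ell+\bar\beta^{b+1}$, where $\ell\ge 0$, the $\zeta^m$ are proper $L^*$-blocks with pairwise disjoint support intervals, and $b$ is the largest index in these intervals ($b=0$ if $\ell=0$). Let $\omega$ be the only positive zero of $-1+\sum_{k=1}^{N-1}e_kx^k+(1+e_N)x^N$, and let $Q_k=\omega^k$. **Setting.** Let $\widetilde L$ be a second such list, let $\widetilde{\mathcal E},\widetilde{\mathcal E}^*,\widetilde\omega,\widetilde Q$ be the corresponding objects, and assume $\mathcal E\subsetneq\widetilde{\mathcal E}$. Put $\phi=1/\omega$, $\widetilde\phi=1/\widetilde\omega$ and $\gamma=\log_{\widetilde\phi}\phi$, and write $\sum\epsilon Q=\sum_{k\ge1}\epsilon_kQ_k$. Write $\mu<_{\mathrm a}\nu$ (respectively $\mu<_{\mathrm d}\nu$) if at the largest (respectively smallest) index where $\mu$ and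 $\nu$ differ the entry of $\mu$ is smaller. For a non-zero finitely supported $\mu$, let $\overline\mu$ be the immediate successor in $(\mathcal E,<_{\mathrm a})$ of the largest member of $\mathcal E$ that is $<_{\mathrm a}\mu$. For $\epsilon\in\widetilde{\mathcal E}^*$ let $\overline{\mathrm{rev}}(\epsilon)=\bar\beta^1$ if $\bar\beta^1\le_{\mathrm d}\epsilon$, and $\overline{\mathrm{rev}}(\epsilon)=\lim_{n\to\infty}\mathrm{rev}_n\bigl(\overline{\mathrm{rev}_n(\epsilon)}\bigr)$ (entrywise) if $\epsilon<_{\mathrm d}\bar\beta^1$. Define $\delta_1^*:[\widetilde\omega,1)\to\mathbb R$ by $$\delta_1^*\Bigl(\sum\epsilon\widetilde Q\Bigr)=\frac{\sum\overline{\mathrm{rev}}(\epsilon)\,Q}{\bigl(\sum\epsilon\widetilde Q\bigr)^\gamma}\qquad(\epsilon\in\widetilde{\mathcal E}^*),$$ and the fluctuation function $\delta^*:(0,1)\to\mathbb R$ by $\delta^*(y)=\delta_1^*(y/\widetilde\omega^{\,n-1})$, where $n\ge1$ is the integer with $\widetilde\omega^{\,n}\le y<\widetilde\omega^{\,n-1}$.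 Let $$U=\Bigl\{\sum\epsilon\widetilde Q:\epsilon\in\widetilde{\mathcal E}^*\setminus\overline{\mathcal E^*}\Bigr\},\qquad X=\Bigl\{\sum\epsilon\widetilde Q:\epsilon\in\overline{\mathcal E^*}\setminus\widetilde{\mathcal E}^*\Bigr\};$$ in particular $X=\emptyset$ whenever $\overline{\mathcal E^*}\subseteq\widetilde{\mathcal E}^*$. **Theorem.** 1. The definitions make sense: $Q$ and $\widetilde Q$ are strictly decreasing sequences in $(0,1)$, the maps $\epsilon\mapsto\sum\epsilon Q$ and $\epsilon\mapsto\sum\epsilon\widetilde Q$ are bijections $\mathcal E^*\to(0,1)$ and $\widetilde{\mathcal E}^*\to(0,1)$, and the limit defining $\overline{\mathrm{rev}}(\epsilon)$ exists for every $\epsilon\in\widetilde{\mathcal E}^*$ with $\epsilon<_{\mathrm d}\bar\beta^1$. 2. $\delta^*$ is continuous on $(0,1)$. 3. $\delta^*$ is locally decreasing and differentiable on $U\setminus X$: every $x\in U\setminus X$ has a neighbourhood on which $\delta^*$ is strictly decreasing, and $\delta^*$ is differentiable at $x$. In particular this holds on all of $U$ if $\overline{\mathcal E^*}\subseteq\widetilde{\mathcal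 E}^*$. -/

import Mathlib

open Filter Topology Set

namespace GenZeck

/-! A coefficient function is a sequence of natural numbers, `ℕ → ℕ`.  All indices start at `0`:
entry `k` here is the entry with number `k + 1` when one counts from `1`. -/

/-- Admissible lists `(e₁, …, e_N)`: `N ≥ 2` and `e₁ ≠ 0`. -/
def IsAdmissible (L : List ℕ) : Prop := 2 ≤ L.length ∧ L.getD 0 0 ≠ 0

/-- The periodic sequence `e₁, …, e_N, e₁, …, e_N, …` -/
def periodic (L : List ℕ) (k : ℕ) : ℕ := L.getD (k % L.length) 0

/-- The first `n` entries of `μ` in reverse order, followed by zeros. -/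
def rev (n : ℕ) (μ : ℕ → ℕ) (k : ℕ) : ℕ := if k < n then μ (n - 1 - k) else 0

/-- Ascending lexicographical order: the largest index where the two differ decides. -/
def AscLt (μ ν : ℕ → ℕ) : Prop := ∃ k, (∀ j, k < j → μ j = ν j) ∧ μ k < ν k

/-- Descending lexicographical order: the smallest index where the two differ decides. -/
def DescLt (μ ν : ℕ → ℕ) : Prop := ∃ k, (∀ j, j < k → μ j = ν j) ∧ μ k < ν k

/-! ### The collection for positive integers -/

/-- `ζ` is a proper `L`-block at index `t` with support interval `[k, t]`. -/
def IsProperBlock (L : List ℕ) (k t : ℕ) (ζ : ℕ → ℕ) : Prop :=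
  k ≤ t ∧ (∀ j, k < j → ζ j = rev (t + 1) (periodic L) j) ∧
    ζ k < rev (t + 1) (periodic L) k ∧ ∀ j, j < k → ζ j = 0

/-- `ζ` is the maximal `L`-block at index `t`, with support interval `[k, t] = [0, t]`. -/
def IsMaximalBlock (L : List ℕ) (k t : ℕ) (ζ : ℕ → ℕ) : Prop :=
  k = 0 ∧ ζ = rev (t + 1) (periodic L)

/-- The periodic Zeckendorf collection for positive integers determined by `L`:
the sums of finitely many disjoint `L`-blocks. -/
def intCollection (L : List ℕ) : Set (ℕ → ℕ) :=
  {μ | ∃ (s : ℕ) (ζ : Fin s → ℕ → ℕ) (a b : Fin s → ℕ),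
    (∀ m, IsProperBlock L (a m) (b m) (ζ m) ∨ IsMaximalBlock L (a m) (b m) (ζ m)) ∧
    (∀ m m', m ≠ m' → Disjoint (Icc (a m) (b m)) (Icc (a m') (b m'))) ∧
    μ = ∑ m, ζ m}

/-- `ν` is the largest member of `C` below `μ`. -/
def IsLargestBelow (C : Set (ℕ → ℕ)) (μ ν : ℕ → ℕ) : Prop :=
  ν ∈ C ∧ AscLt ν μ ∧ ∀ τ ∈ C, AscLt τ μ → τ = ν ∨ AscLt τ ν

/-- `ν` is the immediate successor of `μ` in `C`, i.e. the smallest member of `C` above `μ`. -/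
def IsImmediateSucc (C : Set (ℕ → ℕ)) (μ ν : ℕ → ℕ) : Prop :=
  ν ∈ C ∧ AscLt μ ν ∧ ∀ τ ∈ C, AscLt μ τ → τ = ν ∨ AscLt ν τ

/-- For a nonzero `μ` with finite support: the immediate successor in the collection of `L` of the
largest member of that collection that is below `μ`. -/
noncomputable def bar (L : List ℕ) (μ : ℕ → ℕ) : ℕ → ℕ :=
  Classical.epsilon fun ν =>
    ∃ c, IsLargestBelow (intCollection L) μ c ∧ IsImmediateSucc (intCollection L) c ν

/-! ### The collection for the unit interval -/

/-- The maximal `L*`-block at index `n`. -/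
def maxBlock (L : List ℕ) (n : ℕ) (k : ℕ) : ℕ := if k < n then 0 else periodic L (k - n)

/-- `ζ` is a proper `L*`-block at index `n` with support interval `[n, k]`. -/
def IsProperStarBlock (L : List ℕ) (n k : ℕ) (ζ : ℕ → ℕ) : Prop :=
  n ≤ k ∧ (∀ j, j < k → ζ j = maxBlock L n j) ∧ ζ k < maxBlock L n k ∧ ∀ j, k < j → ζ j = 0

/-- The periodic Zeckendorf collection for `(0, 1)` determined by `L`: the nonzero finite or
infinite sums of disjoint proper `L*`-blocks.  (At each index at most one summand is nonzero.) -/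
def starCollection (L : List ℕ) : Set (ℕ → ℕ) :=
  {ε | ε ≠ 0 ∧ ∃ (S : Set ℕ) (ζ : ℕ → ℕ → ℕ) (a b : ℕ → ℕ),
    (∀ m ∈ S, IsProperStarBlock L (a m) (b m) (ζ m)) ∧
    (∀ m ∈ S, ∀ m' ∈ S, m ≠ m' → Disjoint (Icc (a m) (b m)) (Icc (a m') (b m'))) ∧
    ∀ j, ε j = ∑ᶠ m ∈ S, ζ m j}

/-- The collection for `(0, 1)` together with all sums of finitely many disjoint proper
`L*`-blocks and the maximal `L*`-block that starts right after the last support interval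
(at index `0` if there is no proper block). -/
def starClosure (L : List ℕ) : Set (ℕ → ℕ) :=
  starCollection L ∪
  {ε | ∃ (s : ℕ) (ζ : Fin s → ℕ → ℕ) (a b : Fin s → ℕ) (c : ℕ),
    (∀ m, IsProperStarBlock L (a m) (b m) (ζ m)) ∧
    (∀ m m', m ≠ m' → Disjoint (Icc (a m) (b m)) (Icc (a m') (b m'))) ∧
    (∀ m, b m < c) ∧ ((s = 0 ∧ c = 0) ∨ ∃ m, b m + 1 = c) ∧
    ε = ∑ m, ζ m + maxBlock L c}

/-- The evaluation `∑ εₖ Qₖ`. -/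
noncomputable def eval (Q : ℕ → ℝ) (ε : ℕ → ℕ) : ℝ := ∑' k, (ε k : ℝ) * Q k

/-- `Q` is a fundamental sequence of the collection `C` for `(0, 1)`: a decreasing sequence in
`(0, 1)` whose evaluation map is a bijection of `C` onto `(0, 1)`. -/
def IsFundamentalSeq (C : Set (ℕ → ℕ)) (Q : ℕ → ℝ) : Prop :=
  (∀ n, Q n ∈ Ioo (0 : ℝ) 1) ∧ StrictAnti Q ∧ BijOn (eval Q) C (Ioo 0 1)

/-- The characteristic polynomial
`-1 + ∑_{1 ≤ k ≤ N - 1} eₖ xᵏ + (1 + e_N) x^N` of `L` for `(0, 1)`. -/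
def charPoly (L : List ℕ) (x : ℝ) : ℝ :=
  -1 + ∑ k ∈ Finset.range (L.length - 1), (L.getD k 0 : ℝ) * x ^ (k + 1)
    + (1 + (L.getD (L.length - 1) 0 : ℝ)) * x ^ L.length

theorem existsUnique_charPoly_zero (L : List ℕ) (hL : IsAdmissible L) :
    ∃! x : ℝ, 0 < x ∧ charPoly L x = 0 := by
  obtain ⟨h2, -⟩ := hL
  have hmono : ∀ x y : ℝ, 0 ≤ x → x < y → charPoly L x < charPoly L y := by
    intro x y hx hxy
    unfold charPoly
    have h1 : ∑ k ∈ Finset.range (L.length - 1), (L.getD k 0 : ℝ) * x ^ (k + 1)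
        ≤ ∑ k ∈ Finset.range (L.length - 1), (L.getD k 0 : ℝ) * y ^ (k + 1) := by
      gcongr
    have h3 : x ^ L.length < y ^ L.length := pow_lt_pow_left₀ hxy hx (by omega)
    have h4 : (1 + (L.getD (L.length - 1) 0 : ℝ)) * x ^ L.length
        < (1 + (L.getD (L.length - 1) 0 : ℝ)) * y ^ L.length := by
      apply mul_lt_mul_of_pos_left h3; positivity
    linarith
  have hc : Continuous (charPoly L) := by unfold charPoly; fun_prop
  have h0 : charPoly L 0 = -1 := by
    have : L.length ≠ 0 := by omega
    simp [charPoly, this]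
  have h1 : 0 ≤ charPoly L 1 := by
    unfold charPoly
    have : (0 : ℝ) ≤ ∑ k ∈ Finset.range (L.length - 1), (L.getD k 0 : ℝ) * 1 ^ (k + 1) := by
      positivity
    have : (0 : ℝ) ≤ (L.getD (L.length - 1) 0 : ℝ) := by positivity
    simp only [one_pow, mul_one] at *
    linarith
  obtain ⟨x, hx, hx0⟩ := intermediate_value_Icc (zero_le_one' ℝ) hc.continuousOn
    (show (0 : ℝ) ∈ Icc (charPoly L 0) (charPoly L 1) from ⟨by rw [h0]; norm_num, h1⟩)
  have hxpos : 0 < x := by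
    rcases hx.1.lt_or_eq with h | h
    · exact h
    · rw [← h, h0] at hx0; norm_num at hx0
  refine ⟨x, ⟨hxpos, hx0⟩, ?_⟩
  rintro y ⟨hy, hy0⟩
  rcases lt_trichotomy x y with h | h | h
  · have := hmono x y hxpos.le h; linarith
  · exact h.symm
  · have := hmono y x hy.le h; linarith

/-- `ω`, the only positive zero of the characteristic polynomial of `L` for `(0, 1)`. -/
noncomputable def omega (L : List ℕ) : ℝ :=
  Classical.epsilon fun x : ℝ => 0 < x ∧ charPoly L x = 0

/-- The sequence `ω, ω², ω³, …` -/
noncomputable def fundSeq (L : List ℕ) (k : ℕ) : ℝ := omega L ^ (k + 1)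

/-! ### The fluctuation function.  `L` determines the smaller and `M` the larger collection. -/

/-- `γ`, the logarithm of `φ = 1 / ω(L)` to the base `1 / ω(M)`. -/
noncomputable def gamma (L M : List ℕ) : ℝ := Real.logb (omega M)⁻¹ (omega L)⁻¹

open Classical in
/-- The map that sends a member `ε` of the larger collection for `(0, 1)` to the maximal block
`maxBlock L 0` if that is at most `ε`, and otherwise to the limit below, which is taken entry by entry
 (the product topology of discrete spaces). -/
noncomputable def revBar (L : List ℕ) (ε : ℕ → ℕ) : ℕ → ℕ :=
  if maxBlock L 0 = ε ∨ DescLt (maxBlock L 0) ε then maxBlock L 0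
  else limUnder atTop fun n => rev n (bar L (rev n ε))

/-- The expansion of `x ∈ (0, 1)` in the collection of `M`. -/
noncomputable def expansion (M : List ℕ) (x : ℝ) : ℕ → ℕ :=
  Classical.epsilon fun ε => ε ∈ starCollection M ∧ eval (fundSeq M) ε = x

/-- The function `δ₁*` on `[ω(M), 1)`. -/
noncomputable def deltaOne (L M : List ℕ) (x : ℝ) : ℝ :=
  eval (fundSeq L) (revBar L (expansion M x)) / x ^ gamma L M

/-- The fluctuation function `δ*` on `(0, 1)`: if `ω(M)ⁿ⁺¹ ≤ y < ω(M)ⁿ`, then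
`δ*(y) = δ₁*(y / ω(M)ⁿ)`. -/
noncomputable def delta (L M : List ℕ) (y : ℝ) : ℝ :=
  deltaOne L M (y / omega M ^
    (Classical.epsilon fun n : ℕ => omega M ^ (n + 1) ≤ y ∧ y < omega M ^ n))

/-- `U`: the values of the members of the collection of `M` for `(0, 1)` outside the closure of
the collection of `L`. -/
noncomputable def regularSet (L M : List ℕ) : Set ℝ :=
  eval (fundSeq M) '' (starCollection M \ starClosure L)

/-- The values of those members of the closure of the collection of `L` that are not in the
collection of `M`; there are none if the closure is contained in the collection of `M`. -/
noncomputable def exceptionalSet (L M : List ℕ) : Set ℝ :=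
  eval (fundSeq M) '' (starClosure L \ starCollection M)

end GenZeck

/-! Both collections are described by one automaton. A sequence is read entry by entry against `e =
periodic L`, and `matchLen` is its state: an entry equal to the expected one prolongs the match, a
smaller one ends a block and resets the state, and a larger one is forbidden. The members of
`starCollection L` are the nonzero admitted sequences with infinitely many resets
(`mem_starCollection_iff`), every nonzero admitted sequence lies in `starClosure L`, and the members
of `intCollection L` are the reversed finite words of admitted sequences. Thus `rev n (bar L (rev n
ε))` is the least admitted word above the first `n` entries of `ε`. These words increase with `n`,
so they converge.

Since `e` is an expansion of `1` in base `1 / ω`, evaluation preserves the lexicographic order of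
admitted sequences, and greedy expansion gives the bijection with `(0, 1)`. Let `F` be `numerator L
M`, the map from `∑ ε Q̃` to the value of `revBar L ε`. It is increasing in the weak sense. It takes
every value in `(0, 1)`, because `revBar` fixes the members of `starCollection L`, which all lie in
`starCollection M`. A monotone function without gaps in its values is continuous. A leading zero
scales both evaluations, so `F (ω̃ x) = ω F x`; as `ω̃ ^ γ = ω`, the periodic extension is simply `F
y / y ^ γ` (`delta_eq`).

The values of the sequences admitted by `L`, evaluated in the base of `M`, form a compact set. A
point of `U` outside `X` is not in it, so some interval around the point avoids it. If `F` were not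
constant there, an intermediate value would be attained inside the interval at a member of
`starCollection L`, a contradiction. Hence the fluctuation function is locally a positive constant
times `y ^ (-γ)`. -/

namespace GenZeck

/-! ### Reading a sequence block by block -/

/-- The length of the block of `e` that is being matched just before entry `k` of `ε` is read. -/
def matchLen (e ε : ℕ → ℕ) : ℕ → ℕ
  | 0 => 0
  | k + 1 => if ε k = e (matchLen e ε k) then matchLen e ε k + 1 else 0

/-- `ε` never exceeds the entry of `e` that it is compared with. -/
def Admits (e ε : ℕ → ℕ) : Prop := ∀ k, ε k ≤ e (matchLen e ε k)

/-- Infinitely many blocks of `ε` end. -/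
def Recurrent (e ε : ℕ → ℕ) : Prop := ∀ n, ∃ k, n ≤ k ∧ ε k < e (matchLen e ε k)

theorem matchLen_succ_of_eq {e ε : ℕ → ℕ} {k : ℕ} (h : ε k = e (matchLen e ε k)) :
    matchLen e ε (k + 1) = matchLen e ε k + 1 := by simp [matchLen, h]

theorem matchLen_succ_of_lt {e ε : ℕ → ℕ} {k : ℕ} (h : ε k < e (matchLen e ε k)) :
    matchLen e ε (k + 1) = 0 := by simp [matchLen, h.ne]

theorem matchLen_congr {e ε ε' : ℕ → ℕ} {k : ℕ} (h : ∀ j < k, ε j = ε' j) :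
    matchLen e ε k = matchLen e ε' k := by
  induction k with
  | zero => rfl
  | succ k ih =>
    simp only [matchLen]
    rw [ih fun j hj => h j (by omega), h k (by omega)]

theorem matchLen_self (e : ℕ → ℕ) (k : ℕ) : matchLen e e k = k := by
  induction k with
  | zero => rfl
  | succ k ih => simp [matchLen, ih]

theorem admits_self (e : ℕ → ℕ) : Admits e e := fun k => by rw [matchLen_self]

theorem matchLen_le (e ε : ℕ → ℕ) (k : ℕ) : matchLen e ε k ≤ k := by
  induction k with
  | zero => rfl
  | succ k ih => simp only [matchLen]; split_ifs <;> omega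

/-- Inside the current block, `ε` agrees with `e`. -/
theorem matchLen_of_mem_block (e ε : ℕ → ℕ) (k j : ℕ) (h1 : k - matchLen e ε k ≤ j) (h2 : j < k) :
    matchLen e ε j = j - (k - matchLen e ε k) ∧ ε j = e (j - (k - matchLen e ε k)) := by
  induction k with
  | zero => omega
  | succ k ih =>
    have hk := matchLen_le e ε k
    by_cases h : ε k = e (matchLen e ε k)
    · rw [matchLen_succ_of_eq h] at h1 ⊢
      have : k + 1 - (matchLen e ε k + 1) = k - matchLen e ε k := by omega
      rw [this] at h1 ⊢
      rcases Nat.lt_succ_iff_lt_or_eq.1 h2 with h3 | rfl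
      · exact ih h1 h3
      · have : j - (j - matchLen e ε j) = matchLen e ε j := by omega
        rw [this]; exact ⟨rfl, h⟩
    · simp only [matchLen, h, if_false] at h1; omega

theorem matchLen_of_no_reset {e ε : ℕ → ℕ} (hA : Admits e ε) {j k : ℕ} (hjk : j ≤ k)
    (h : ∀ i, j ≤ i → i < k → ¬ ε i < e (matchLen e ε i)) :
    matchLen e ε k = matchLen e ε j + (k - j) := by
  induction k, hjk using Nat.le_induction with
  | base => simp
  | succ k hk ih =>
    rw [matchLen_succ_of_eq (le_antisymm (hA k) (not_lt.1 (h k hk (by omega)))),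
      ih fun i h1 h2 => h i h1 (by omega)]
    omega

/-- A block starts after every earlier reset. -/
theorem lt_block_start_of_reset {e ε : ℕ → ℕ} {b b' : ℕ} (h : ε b < e (matchLen e ε b))
    (hbb : b < b') : b < b' - matchLen e ε b' := by
  by_contra! hc
  obtain ⟨h1, h2⟩ := matchLen_of_mem_block e ε b' b hc hbb
  rw [h1, h2] at h
  exact lt_irrefl _ h

/-- The sequence that puts a zero in front of `ε`. -/
def consZero (ε : ℕ → ℕ) : ℕ → ℕ
  | 0 => 0
  | k + 1 => ε k

/-- As `e 0 ≠ 0`, a leading zero is a complete block by itself, and reading starts afresh after it.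
-/
theorem matchLen_consZero {e : ℕ → ℕ} (he : e 0 ≠ 0) (ε : ℕ → ℕ) (k : ℕ) :
    matchLen e (consZero ε) (k + 1) = matchLen e ε k := by
  induction k with
  | zero => simp [matchLen, consZero, he.symm]
  | succ k ih => rw [matchLen, ih]; rfl

theorem admits_consZero_iff {e : ℕ → ℕ} (he : e 0 ≠ 0) (ε : ℕ → ℕ) :
    Admits e (consZero ε) ↔ Admits e ε := by
  constructor
  · intro h k
    have := h (k + 1)
    rwa [matchLen_consZero he] at this
  · rintro h (_ | k)
    · simp [consZero]
    · rw [matchLen_consZero he]; exact h k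

theorem Recurrent.consZero {e : ℕ → ℕ} (he : e 0 ≠ 0) {ε : ℕ → ℕ} (h : Recurrent e ε) :
    Recurrent e (consZero ε) := by
  intro n
  obtain ⟨k, hk, hlt⟩ := h n
  exact ⟨k + 1, by omega, by rw [matchLen_consZero he]; exact hlt⟩

/-- Without further resets the tail would copy `e`, whose entries do not vanish eventually. -/
theorem recurrent_of_eventually_zero {e ε : ℕ → ℕ} (he : ∀ n, ∃ k, n ≤ k ∧ e k ≠ 0)
    (hA : Admits e ε) {n : ℕ} (h : ∀ k, n ≤ k → ε k = 0) : Recurrent e ε := by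
  intro m
  by_contra! hc
  set s := matchLen e ε (max m n)
  obtain ⟨k, hk, hek⟩ := he s
  have h1 := matchLen_of_no_reset hA (show max m n ≤ max m n + (k - s) by omega)
    fun i h1 h2 => not_lt.2 (hc i (by omega))
  have h2 := hc (max m n + (k - s)) (by omega)
  rw [h1, h _ (by omega)] at h2
  apply hek
  have : matchLen e ε (max m n) + (max m n + (k - s) - max m n) = k := by
    change s + _ = k; omega
  rw [this] at h2; omega

/-- If `e` is read successfully along `f`, then reading along `f` follows reading along `e`. -/
theorem matchLen_matchLen {e f ε : ℕ → ℕ} (hef : Admits f e) (hA : Admits e ε) (k : ℕ) :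
    matchLen f ε k = matchLen f e (matchLen e ε k) := by
  induction k with
  | zero => rfl
  | succ k ih =>
    rcases (hA k).lt_or_eq with h | h
    -- A reset along `e` is also one along `f`, because the entry of `e` is at most the expected
    -- entry of `f`.
    · rw [matchLen_succ_of_lt h, matchLen_succ_of_lt]
      · rfl
      · rw [ih]; exact h.trans_le (hef _)
    · rw [matchLen_succ_of_eq h]
      simp only [matchLen, ih, h]

theorem Admits.trans {e f ε : ℕ → ℕ} (hef : Admits f e) (hA : Admits e ε) : Admits f ε := fun k => by
  rw [matchLen_matchLen hef hA]; exact (hA k).trans (hef _)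

theorem Recurrent.trans {e f ε : ℕ → ℕ} (hef : Admits f e) (hA : Admits e ε) (h : Recurrent e ε) :
    Recurrent f ε := fun n => by
  obtain ⟨k, hk, hlt⟩ := h n
  exact ⟨k, hk, by rw [matchLen_matchLen hef hA]; exact hlt.trans_le (hef _)⟩

/-! ### Descending order and truncation -/

theorem descLt_iff {μ ν : ℕ → ℕ} : DescLt μ ν ↔ toLex μ < toLex ν := Iff.rfl

/-- Up to the first difference from `e` everything matches, so there `ε` is compared with the entry
of `e` at the same index. -/
theorem Admits.toLex_le {e ε : ℕ → ℕ} (hA : Admits e ε) : toLex ε ≤ toLex e := by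
  by_contra! h
  obtain ⟨k, hk, hlt⟩ := h
  change ∀ j < k, e j = ε j at hk
  have : matchLen e ε k = k := by
    rw [matchLen_congr (ε' := e) fun j hj => (hk j hj).symm, matchLen_self]
  have h2 := hA k
  rw [this] at h2
  exact absurd hlt (not_lt.2 h2)

theorem Recurrent.ne {e ε : ℕ → ℕ} (h : Recurrent e ε) : ε ≠ e := by
  rintro rfl
  obtain ⟨k, -, hk⟩ := h 0
  rw [matchLen_self] at hk
  exact lt_irrefl _ hk

theorem rev_rev (n : ℕ) (ε : ℕ → ℕ) (k : ℕ) : rev n (rev n ε) k = if k < n then ε k else 0 := by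
  unfold rev
  split_ifs with h1 h2
  · congr 1; omega
  · omega
  · rfl

theorem rev_rev_of_support {n : ℕ} {μ : ℕ → ℕ} (h : ∀ k, n ≤ k → μ k = 0) : rev n (rev n μ) = μ := by
  ext k
  rw [rev_rev]
  split_ifs with h1
  · rfl
  · exact (h k (by omega)).symm

theorem rev_eq_zero_of_le {n k : ℕ} (h : n ≤ k) (ε : ℕ → ℕ) : rev n ε k = 0 := by
  simp [rev, not_lt.2 h]

theorem rev_sub {n j : ℕ} (h : j < n) (ε : ℕ → ℕ) : rev n ε (n - 1 - j) = ε j := by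
  unfold rev
  rw [if_pos (by omega)]
  congr 1; omega

theorem rev_succ {n : ℕ} {μ : ℕ → ℕ} (h : μ n = 0) : rev (n + 1) μ = consZero (rev n μ) := by
  ext k
  cases k with
  | zero => simp [rev, consZero, h]
  | succ k =>
    simp only [rev, consZero]
    split_ifs with h1 h2 h2
    · congr 1; omega
    · omega
    · omega
    · rfl

theorem toLex_le_iff {μ ν : ℕ → ℕ} :
    toLex μ ≤ toLex ν ↔ μ = ν ∨ DescLt μ ν := by
  rw [le_iff_eq_or_lt]
  exact or_congr toLex_inj descLt_iff.symm

theorem toLex_rev_rev_mono {ε ε' : ℕ → ℕ} (h : toLex ε ≤ toLex ε') (n : ℕ) :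
    toLex (rev n (rev n ε)) ≤ toLex (rev n (rev n ε')) := by
  rcases toLex_le_iff.1 h with rfl | ⟨k, hk, hlt⟩
  · rfl
  · rw [toLex_le_iff]
    by_cases hkn : k < n
    · right
      refine ⟨k, fun j hj => ?_, ?_⟩
      · simp only [rev_rev, hk j hj]
      · simpa only [rev_rev, hkn, if_true] using hlt
    · left
      ext j
      simp only [rev_rev]
      split_ifs with hj
      · exact hk j (by omega)
      · rfl

theorem toLex_rev_rev_le (ε : ℕ → ℕ) (n : ℕ) : toLex (rev n (rev n ε)) ≤ toLex ε := by
  by_contra! h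
  obtain ⟨k, -, hlt⟩ := h
  change ε k < rev n (rev n ε) k at hlt
  rw [rev_rev] at hlt
  split_ifs at hlt <;> omega

/-- The ascending order is the descending order of the reversals. -/
theorem ascLt_iff_rev {n : ℕ} {μ ν : ℕ → ℕ} (hμ : ∀ k, n ≤ k → μ k = 0) (hν : ∀ k, n ≤ k → ν k = 0) :
    AscLt μ ν ↔ DescLt (rev n μ) (rev n ν) := by
  constructor
  · rintro ⟨k, hk, hlt⟩
    have hkn : k < n := by
      by_contra! h
      rw [hμ k h, hν k h] at hlt; omega
    refine ⟨n - 1 - k, fun j hj => ?_, ?_⟩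
    · simp only [rev]; rw [hk _ (by omega)]
    · rwa [rev_sub hkn, rev_sub hkn]
  · rintro ⟨k, hk, hlt⟩
    have hkn : k < n := by
      by_contra! h
      rw [rev_eq_zero_of_le h, rev_eq_zero_of_le h] at hlt; omega
    refine ⟨n - 1 - k, fun j hj => ?_, ?_⟩
    · by_cases hjn : j < n
      · have := hk (n - 1 - j) (by omega)
        rwa [rev_sub hjn, rev_sub hjn] at this
      · rw [hμ j (by omega), hν j (by omega)]
    · simpa [rev, hkn] using hlt

theorem AscLt.support {n : ℕ} {μ ν : ℕ → ℕ} (h : AscLt μ ν) (hν : ∀ k, n ≤ k → ν k = 0) :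
    ∀ k, n ≤ k → μ k = 0 := by
  obtain ⟨i, hi, hlt⟩ := h
  intro k hk
  have : i < n := by
    by_contra! hc
    rw [hν i hc] at hlt; omega
  rw [hi k (by omega), hν k hk]

/-! ### The collections in terms of reading -/

theorem IsAdmissible.periodic_zero {L : List ℕ} (hL : IsAdmissible L) : periodic L 0 ≠ 0 := by
  have := hL.2; simpa [periodic] using this

theorem finsum_prop_eq_zero {p : Prop} {x : ℕ} (h : p → x = 0) : ∑ᶠ _ : p, x = 0 := by
  by_cases hp : p
  · simp [hp, h hp]
  · simp [hp]

/-- The automaton recovers the given blocks: its state is the offset inside a block and `0` outside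
all blocks. An uncovered index carries a zero, which resets because `e 0 ≠ 0`. -/
theorem admits_of_starBlocks {L : List ℕ} (hL : IsAdmissible L) {ε : ℕ → ℕ} {S : Set ℕ}
    {ζ : ℕ → ℕ → ℕ} {a b : ℕ → ℕ} (hζ : ∀ m ∈ S, IsProperStarBlock L (a m) (b m) (ζ m))
    (hd : ∀ m ∈ S, ∀ m' ∈ S, m ≠ m' → Disjoint (Icc (a m) (b m)) (Icc (a m') (b m')))
    (hε : ∀ j, ε j = ∑ᶠ m ∈ S, ζ m j) :
    Admits (periodic L) ε ∧ Recurrent (periodic L) ε := by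
  have he0 := hL.periodic_zero
  have hout : ∀ m ∈ S, ∀ j, ¬ (a m ≤ j ∧ j ≤ b m) → ζ m j = 0 := by
    intro m hm j hj
    obtain ⟨h1, h2, h3, h4⟩ := hζ m hm
    rcases lt_or_ge (b m) j with h | h
    · exact h4 j h
    · rw [h2 j (by omega), maxBlock, if_pos (by omega)]
  have hin : ∀ m ∈ S, ∀ j, a m ≤ j → j ≤ b m → ε j = ζ m j := by
    intro m hm j h1 h2
    rw [hε, finsum_eq_single _ m]
    · simp [hm]
    · intro m' hne
      refine finsum_prop_eq_zero fun hm' => ?_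
      apply hout m' hm'
      intro hj
      exact Set.disjoint_left.1 (hd m hm m' hm' hne.symm) ⟨h1, h2⟩ hj
  have hno : ∀ j, (∀ m ∈ S, ¬ (a m ≤ j ∧ j ≤ b m)) → ε j = 0 := by
    intro j hj
    rw [hε]
    exact finsum_eq_zero_of_forall_eq_zero fun m =>
      finsum_prop_eq_zero fun hm => hout m hm j (hj m hm)
  have hdig : ∀ m ∈ S, ∀ j, a m ≤ j → j < b m → ε j = periodic L (j - a m) := by
    intro m hm j h1 h2
    rw [hin m hm j h1 h2.le, (hζ m hm).2.1 j h2, maxBlock, if_neg (by omega)]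
  have hend : ∀ m ∈ S, ε (b m) < periodic L (b m - a m) := by
    intro m hm
    obtain ⟨h1, h2, h3, h4⟩ := hζ m hm
    rw [hin m hm _ h1 le_rfl]
    rwa [maxBlock, if_neg (by omega)] at h3
  have key : ∀ k, (∀ m ∈ S, a m ≤ k → k ≤ b m → matchLen (periodic L) ε k = k - a m) ∧
      ((∀ m ∈ S, ¬ (a m ≤ k ∧ k ≤ b m)) → matchLen (periodic L) ε k = 0) := by
    intro k
    induction k with
    | zero => exact ⟨fun m _ _ _ => by simp [matchLen], fun _ => rfl⟩
    | succ k ih =>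
      by_cases hk : ∃ m ∈ S, a m ≤ k ∧ k ≤ b m
      · obtain ⟨m, hm, h1, h2⟩ := hk
        have h3 := ih.1 m hm h1 h2
        rcases h2.lt_or_eq with h2 | h2
        · have h4 : matchLen (periodic L) ε (k + 1) = k - a m + 1 := by
            rw [matchLen_succ_of_eq, h3]; rw [h3]; exact hdig m hm k h1 h2
          constructor
          · intro m' hm' h5 h6
            have : m = m' := by
              by_contra hne
              exact Set.disjoint_left.1 (hd m hm m' hm' hne) (show k + 1 ∈ _ from ⟨by omega, h2⟩) ⟨h5, h6⟩
            subst this; omega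
          · intro h; exact absurd ⟨by omega, h2⟩ (h m hm)
        · have h4 : matchLen (periodic L) ε (k + 1) = 0 := by
            apply matchLen_succ_of_lt; rw [h3, h2]; exact hend m hm
          refine ⟨fun m' hm' h5 h6 => ?_, fun _ => h4⟩
          rw [h4]
          by_contra hne
          have hmm : m ≠ m' := by rintro rfl; omega
          exact Set.disjoint_left.1 (hd m hm m' hm' hmm) (show k ∈ _ from ⟨h1, h2.le⟩) ⟨by omega, by omega⟩
      · push Not at hk
        have h3 := ih.2 fun m hm h => absurd h.2 (not_le.2 (hk m hm h.1))
        have h4 : matchLen (periodic L) ε (k + 1) = 0 := by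
          apply matchLen_succ_of_lt
          rw [h3, hno k fun m hm h => absurd h.2 (not_le.2 (hk m hm h.1))]
          omega
        refine ⟨fun m' hm' h5 h6 => ?_, fun _ => h4⟩
        rw [h4]
        by_contra hne
        have := hk m' hm' (by omega)
        omega
  constructor
  · intro k
    by_cases hk : ∃ m ∈ S, a m ≤ k ∧ k ≤ b m
    · obtain ⟨m, hm, h1, h2⟩ := hk
      rw [(key k).1 m hm h1 h2]
      rcases h2.lt_or_eq with h2 | rfl
      · exact (hdig m hm k h1 h2).le
      · exact (hend m hm).le
    · push Not at hk
      rw [hno k fun m hm h => absurd h.2 (not_le.2 (hk m hm h.1))]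
      omega
  · intro k
    by_cases hk : ∃ m ∈ S, a m ≤ k ∧ k ≤ b m
    · obtain ⟨m, hm, h1, h2⟩ := hk
      refine ⟨b m, h2, ?_⟩
      rw [(key _).1 m hm (hζ m hm).1 le_rfl]
      exact hend m hm
    · push Not at hk
      have hk' : ∀ m ∈ S, ¬ (a m ≤ k ∧ k ≤ b m) :=
        fun m hm h => absurd h.2 (not_le.2 (hk m hm h.1))
      refine ⟨k, le_rfl, ?_⟩
      rw [hno k hk', (key k).2 hk']
      omega

/-- The block of `ε` that ends at `b`. -/
def blockAt (e ε : ℕ → ℕ) (b j : ℕ) : ℕ := if b - matchLen e ε b ≤ j ∧ j ≤ b then ε j else 0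

theorem isProperStarBlock_blockAt {L : List ℕ} {ε : ℕ → ℕ} {b : ℕ}
    (hb : ε b < periodic L (matchLen (periodic L) ε b)) :
    IsProperStarBlock L (b - matchLen (periodic L) ε b) b (blockAt (periodic L) ε b) := by
  have hle := matchLen_le (periodic L) ε b
  refine ⟨by omega, fun j hj => ?_, ?_, fun j hj => ?_⟩
  · unfold blockAt maxBlock
    split_ifs with h1 h2 h2
    · omega
    · exact (matchLen_of_mem_block _ ε b j h1.1 hj).2
    · rfl
    · omega
  · unfold blockAt maxBlock
    rw [if_pos (by omega), if_neg (by omega)]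
    rwa [show b - (b - matchLen (periodic L) ε b) = matchLen (periodic L) ε b by omega]
  · rw [blockAt, if_neg (by omega)]

theorem disjoint_blocks {e ε : ℕ → ℕ} {b b' : ℕ} (hb : ε b < e (matchLen e ε b))
    (hb' : ε b' < e (matchLen e ε b')) (hne : b ≠ b') :
    Disjoint (Icc (b - matchLen e ε b) b) (Icc (b' - matchLen e ε b') b') := by
  rw [Set.disjoint_left]
  rintro j ⟨h1, h2⟩ ⟨h3, h4⟩
  rcases lt_or_gt_of_ne hne with h | h
  · have := lt_block_start_of_reset hb h; omega
  · have := lt_block_start_of_reset hb' h; omega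

/-- The block that contains `j` ends at the first reset from `j` on. -/
theorem exists_block {e ε : ℕ → ℕ} (hA : Admits e ε) {j k : ℕ} (hjk : j ≤ k)
    (hk : ε k < e (matchLen e ε k)) :
    ∃ b, j ≤ b ∧ b ≤ k ∧ ε b < e (matchLen e ε b) ∧ b - matchLen e ε b ≤ j := by
  classical
  have h : ∃ k, j ≤ k ∧ ε k < e (matchLen e ε k) := ⟨k, hjk, hk⟩
  obtain ⟨h1, h2⟩ := Nat.find_spec h
  refine ⟨Nat.find h, h1, Nat.find_min' h ⟨hjk, hk⟩, h2, ?_⟩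
  have := matchLen_of_no_reset hA h1 fun i hi hlt hr => Nat.find_min h hlt ⟨hi, hr⟩
  omega

/-- Conversely, the resets serve as labels of the blocks. Recurrence puts every index into a block
that ends. -/
theorem mem_starCollection_iff {L : List ℕ} (hL : IsAdmissible L) {ε : ℕ → ℕ} :
    ε ∈ starCollection L ↔ ε ≠ 0 ∧ Admits (periodic L) ε ∧ Recurrent (periodic L) ε := by
  constructor
  · rintro ⟨h0, S, ζ, a, b, hζ, hd, hε⟩
    exact ⟨h0, admits_of_starBlocks hL hζ hd hε⟩
  · rintro ⟨h0, hA, hR⟩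
    refine ⟨h0, {b | ε b < periodic L (matchLen (periodic L) ε b)}, blockAt (periodic L) ε,
      fun b => b - matchLen (periodic L) ε b, id, fun b hb => isProperStarBlock_blockAt hb,
      fun b hb b' hb' hne => disjoint_blocks hb hb' hne, fun j => ?_⟩
    obtain ⟨k, hjk, hk⟩ := hR j
    obtain ⟨b, h1, -, h2, h3⟩ := exists_block hA hjk hk
    rw [finsum_eq_single _ b]
    · simp [h2, blockAt, h1, h3]
    · intro b' hne
      refine finsum_prop_eq_zero fun hb' => ?_
      rw [blockAt, if_neg]
      exact fun h => Set.disjoint_left.1 (disjoint_blocks h2 hb' hne.symm) ⟨h3, h1⟩ h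

theorem sum_orderEmbOfFin (s : Finset ℕ) (g : ℕ → ℕ → ℕ) :
    ∑ m : Fin s.card, g (s.orderEmbOfFin rfl m) = ∑ b ∈ s, g b := by
  rw [← Finset.sum_coe_sort s]
  exact Fintype.sum_equiv (s.orderIsoOfFin rfl).toEquiv _ _ fun m => rfl

/-- With only finitely many resets, the sequence copies `e` after the last one, and this tail is the
maximal block. -/
theorem mem_starClosure_of_admits {L : List ℕ} (hL : IsAdmissible L) {ε : ℕ → ℕ} (h0 : ε ≠ 0)
    (hA : Admits (periodic L) ε) : ε ∈ starClosure L := by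
  classical
  by_cases hR : Recurrent (periodic L) ε
  · exact Or.inl ((mem_starCollection_iff hL).2 ⟨h0, hA, hR⟩)
  right
  unfold Recurrent at hR
  push Not at hR
  set R : ℕ → Prop := fun b => ε b < periodic L (matchLen (periodic L) ε b) with hRdef
  have hex : ∃ c, ∀ k, c ≤ k → ¬ R k := by
    obtain ⟨n, hn⟩ := hR
    exact ⟨n, fun k hk => not_lt.2 (hn k hk)⟩
  -- The index right after the last reset, or `0` if there is none.
  set c := Nat.find hex with hc
  have hcs : ∀ k, c ≤ k → ¬ R k := Nat.find_spec hex
  have hlast : ∀ d, c = d + 1 → R d := by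
    intro d hd
    by_contra hnd
    apply Nat.find_min hex (show d < c by omega)
    intro k hk
    rcases hk.eq_or_lt with rfl | h
    · exact hnd
    · exact hcs k (by omega)
  have hmc : matchLen (periodic L) ε c = 0 := by
    rcases Nat.eq_zero_or_pos c with h | h
    · rw [h]; rfl
    · obtain ⟨d, hd⟩ : ∃ d, c = d + 1 := ⟨c - 1, by omega⟩
      rw [hd, matchLen_succ_of_lt (hlast d hd)]
  set s := (Finset.range c).filter R with hs
  have hmem : ∀ m : Fin s.card, R (s.orderEmbOfFin rfl m) ∧ s.orderEmbOfFin rfl m < c := by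
    intro m
    have := s.orderEmbOfFin_mem rfl m
    have h2 := Finset.mem_filter.1 this
    exact ⟨h2.2, Finset.mem_range.1 h2.1⟩
  refine ⟨s.card, fun m => blockAt (periodic L) ε (s.orderEmbOfFin rfl m),
    fun m => s.orderEmbOfFin rfl m - matchLen (periodic L) ε (s.orderEmbOfFin rfl m),
    fun m => s.orderEmbOfFin rfl m, c, fun m => isProperStarBlock_blockAt (hmem m).1,
    fun m m' hne => disjoint_blocks (hmem m).1 (hmem m').1 fun h => hne (by simpa using h),
    fun m => (hmem m).2, ?_, ?_⟩
  · rcases Nat.eq_zero_or_pos c with h | h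
    · left; simp [hs, h]
    · right
      have hd : c - 1 ∈ s := by
        rw [hs, Finset.mem_filter, Finset.mem_range]
        exact ⟨by omega, hlast _ (by omega)⟩
      have : c - 1 ∈ Set.range (s.orderEmbOfFin rfl) := by simpa using hd
      obtain ⟨m, hm⟩ := this
      exact ⟨m, by simp only [hm]; omega⟩
  · rw [sum_orderEmbOfFin s (blockAt (periodic L) ε)]
    ext j
    rw [Pi.add_apply, Finset.sum_apply]
    by_cases hj : c ≤ j
    · have h1 : matchLen (periodic L) ε j = j - c := by
        rw [matchLen_of_no_reset hA hj fun i hi _ => hcs i hi, hmc]; omega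
      rw [Finset.sum_eq_zero, zero_add, maxBlock, if_neg (by omega), ← h1]
      · exact le_antisymm (hA j) (not_lt.1 (hcs j hj))
      · intro b hb
        rw [hs, Finset.mem_filter, Finset.mem_range] at hb
        rw [blockAt, if_neg (by omega)]
    · rw [maxBlock, if_pos (by omega), add_zero]
      obtain ⟨b, h1, -, h2, h3⟩ :=
        exists_block hA (show j ≤ c - 1 by omega) (hlast _ (by omega))
      have hbs : b ∈ s := by
        rw [hs, Finset.mem_filter, Finset.mem_range]
        refine ⟨?_, h2⟩
        by_contra! hcb
        exact hcs b hcb h2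
      rw [Finset.sum_eq_single_of_mem b hbs]
      · simp [blockAt, h1, h3]
      · intro b' hb' hne
        rw [hs, Finset.mem_filter] at hb'
        rw [blockAt, if_neg]
        exact fun h => Set.disjoint_left.1 (disjoint_blocks h2 hb'.2 hne.symm) ⟨h3, h1⟩ h

theorem IsAdmissible.periodic_mul {L : List ℕ} (hL : IsAdmissible L) (n : ℕ) :
    ∃ k, n ≤ k ∧ periodic L k ≠ 0 := by
  refine ⟨n * L.length, Nat.le_mul_of_pos_right _ (by have := hL.1; omega), ?_⟩
  have := hL.periodic_zero
  simpa [periodic] using this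

theorem exists_periodic_le (L : List ℕ) : ∃ B, ∀ k, periodic L k ≤ B := by
  refine ⟨L.sum, fun k => ?_⟩
  unfold periodic
  by_cases h : k % L.length < L.length
  · rw [List.getD_eq_getElem _ _ h]
    exact List.single_le_sum (by simp) _ (List.getElem_mem h)
  · rw [List.getD_eq_default _ _ (not_lt.1 h)]; exact Nat.zero_le _

theorem support_of_mem_intCollection {L : List ℕ} {μ : ℕ → ℕ} (h : μ ∈ intCollection L) :
    ∃ n, ∀ k, n ≤ k → μ k = 0 := by
  obtain ⟨s, ζ, a, b, hζ, -, rfl⟩ := h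
  refine ⟨∑ m, (b m + 1), fun k hk => ?_⟩
  rw [Finset.sum_apply]
  refine Finset.sum_eq_zero fun m _ => ?_
  have hbm : b m + 1 ≤ ∑ m, (b m + 1) :=
    Finset.single_le_sum (f := fun m => b m + 1) (fun _ _ => Nat.zero_le _) (Finset.mem_univ m)
  rcases hζ m with ⟨h1, h2, -⟩ | ⟨-, h2⟩
  · rw [h2 k (by omega), rev_eq_zero_of_le (by omega)]
  · rw [h2, rev_eq_zero_of_le (by omega)]

theorem admits_rev_of_le {e : ℕ → ℕ} (he : e 0 ≠ 0) {μ : ℕ → ℕ} {n N : ℕ} (hnN : n ≤ N)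
    (hμ : ∀ k, n ≤ k → μ k = 0) (h : Admits e (rev N μ)) : Admits e (rev n μ) := by
  induction N, hnN using Nat.le_induction with
  | base => exact h
  | succ N hN ih =>
    rw [rev_succ (hμ N hN), admits_consZero_iff he] at h
    exact ih h

/-- After reversal an `L`-block is read from its top index down. A proper block ends with a reset; a
maximal block reaches index `0`, where the word ends, and needs none. -/
theorem admits_rev_of_mem {L : List ℕ} (hL : IsAdmissible L) {μ : ℕ → ℕ}
    (h : μ ∈ intCollection L) {n : ℕ} (hn : ∀ k, n ≤ k → μ k = 0) :
    Admits (periodic L) (rev n μ) := by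
  obtain ⟨s, ζ, a, b, hζ, hd, hμ⟩ := h
  have he0 := hL.periodic_zero
  set e := periodic L with he
  have hab : ∀ m, a m ≤ b m := fun m => by
    rcases hζ m with h | h
    · exact h.1
    · rw [h.1]; exact Nat.zero_le _
  have hrev : ∀ t j, j ≤ t → rev (t + 1) e j = e (t - j) := fun t j hj => by
    rw [rev, if_pos (by omega)]; congr 1
  have hout : ∀ m j, ¬ (a m ≤ j ∧ j ≤ b m) → ζ m j = 0 := by
    intro m j hj
    rcases hζ m with ⟨h1, h2, h3, h4⟩ | ⟨h1, h2⟩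
    · rcases lt_or_ge j (a m) with h | h
      · exact h4 j h
      · rw [h2 j (by omega), rev_eq_zero_of_le (by omega)]
    · rw [h2, rev_eq_zero_of_le (by omega)]
  have hdig : ∀ m j, a m < j → j ≤ b m → ζ m j = e (b m - j) := by
    intro m j h5 h6
    rcases hζ m with ⟨h1, h2, h3, h4⟩ | ⟨h1, h2⟩
    · rw [h2 j h5, hrev _ _ h6]
    · rw [h2, hrev _ _ h6]
  have hend : ∀ m, ζ m (a m) ≤ e (b m - a m) ∧ (a m ≠ 0 → ζ m (a m) < e (b m - a m)) := by
    intro m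
    rcases hζ m with ⟨h1, h2, h3, h4⟩ | ⟨h1, h2⟩
    · rw [hrev _ _ h1] at h3; exact ⟨h3.le, fun _ => h3⟩
    · rw [h2, hrev _ _ (hab m)]; exact ⟨le_rfl, fun h => absurd h1 h⟩
  have hin : ∀ m j, a m ≤ j → j ≤ b m → μ j = ζ m j := by
    intro m j h1 h2
    rw [hμ, Finset.sum_apply]
    refine Finset.sum_eq_single_of_mem m (Finset.mem_univ m) fun m' _ hne => ?_
    exact hout m' j fun hj => Set.disjoint_left.1 (hd m m' hne.symm) ⟨h1, h2⟩ hj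
  have hno : ∀ j, (∀ m, ¬ (a m ≤ j ∧ j ≤ b m)) → μ j = 0 := by
    intro j hj
    rw [hμ, Finset.sum_apply]
    exact Finset.sum_eq_zero fun m _ => hout m j (hj m)
  -- A length that exceeds the top index of every block, even of a block that is zero at its top;
  -- the additional leading zeros are removed by `admits_rev_of_le`.
  set N := n + ∑ m, (b m + 1) with hN
  have hbN : ∀ m, b m < N := fun m => by
    have : b m + 1 ≤ ∑ m, (b m + 1) :=
      Finset.single_le_sum (f := fun m => b m + 1) (fun _ _ => Nat.zero_le _) (Finset.mem_univ m)
    omega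
  apply admits_rev_of_le he0 (show n ≤ N by omega) hn
  have hr : ∀ i k, i + k + 1 = N → rev N μ k = μ i := fun i k h => by
    rw [rev, if_pos (by omega)]; congr 1; omega
  have key : ∀ k i, i + k + 1 = N →
      (∀ m, a m ≤ i → i ≤ b m → matchLen e (rev N μ) k = b m - i) ∧
      ((∀ m, ¬ (a m ≤ i ∧ i ≤ b m)) → matchLen e (rev N μ) k = 0) := by
    intro k
    induction k with
    | zero =>
      intro i hi
      refine ⟨fun m h1 h2 => ?_, fun _ => rfl⟩
      have := hbN m
      simp only [matchLen]; omega
    | succ k ih =>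
      intro i hi
      obtain ⟨ih1, ih2⟩ := ih (i + 1) (by omega)
      have hd1 := hr (i + 1) k (by omega)
      by_cases hk : ∃ m, a m ≤ i + 1 ∧ i + 1 ≤ b m
      · obtain ⟨m, h1, h2⟩ := hk
        have h3 := ih1 m h1 h2
        rcases h1.lt_or_eq with h1' | h1'
        · have h4 : matchLen e (rev N μ) (k + 1) = b m - (i + 1) + 1 := by
            rw [matchLen_succ_of_eq, h3]
            rw [h3, hd1, hin m _ h1 h2, hdig m _ h1' h2]
          constructor
          · intro m' h5 h6
            have : m = m' := by
              by_contra hne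
              exact Set.disjoint_left.1 (hd m m' hne)
                (show i ∈ _ from ⟨by omega, by omega⟩) ⟨h5, h6⟩
            subst this; omega
          · intro h; exact absurd ⟨by omega, by omega⟩ (h m)
        · have h4 : matchLen e (rev N μ) (k + 1) = 0 := by
            apply matchLen_succ_of_lt
            rw [h3, hd1, hin m _ h1 h2, ← h1']
            exact (hend m).2 (by omega)
          refine ⟨fun m' h5 h6 => ?_, fun _ => h4⟩
          rw [h4]
          by_contra hne
          have hmm : m ≠ m' := by rintro rfl; omega
          exact Set.disjoint_left.1 (hd m m' hmm) (show i + 1 ∈ _ from ⟨h1, h2⟩)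
            ⟨by omega, by omega⟩
      · push Not at hk
        have hk' : ∀ m, ¬ (a m ≤ i + 1 ∧ i + 1 ≤ b m) :=
          fun m h => absurd h.2 (not_le.2 (hk m h.1))
        have h4 : matchLen e (rev N μ) (k + 1) = 0 := by
          apply matchLen_succ_of_lt
          rw [ih2 hk', hd1, hno _ hk']
          omega
        refine ⟨fun m' h5 h6 => ?_, fun _ => h4⟩
        rw [h4]
        by_contra hne
        have := hk m' (by omega)
        omega
  intro k
  by_cases hkN : k < N
  · obtain ⟨i, hi⟩ : ∃ i, i + k + 1 = N := ⟨N - 1 - k, by omega⟩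
    rw [hr i k hi]
    by_cases hk : ∃ m, a m ≤ i ∧ i ≤ b m
    · obtain ⟨m, h1, h2⟩ := hk
      rw [(key k i hi).1 m h1 h2, hin m i h1 h2]
      rcases h1.lt_or_eq with h1 | h1
      · exact (hdig m i h1 h2).le
      · rw [← h1]; exact (hend m).1
    · push Not at hk
      rw [hno i fun m h => absurd h.2 (not_le.2 (hk m h.1))]
      exact Nat.zero_le _
  · rw [rev_eq_zero_of_le (not_lt.1 hkN)]; exact Nat.zero_le _

/-- Cutting at `n` may leave an unfinished block. After reversal it reaches index `0` and becomes a
maximal block, while the finished blocks become proper ones. -/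
theorem rev_mem_intCollection {L : List ℕ} {ε : ℕ → ℕ}
    (hA : Admits (periodic L) ε) (n : ℕ) : rev n ε ∈ intCollection L := by
  classical
  set e := periodic L with he
  -- The label `n` stands for the unfinished block, which occupies the entries before `n`. Entry `n`
  -- of `blockAt` is dropped by `rev n`, and `n - 1 - n = 0` is the required lower end of the
  -- support.
  set P : ℕ → Prop := fun b => (b < n ∧ ε b < e (matchLen e ε b)) ∨ (b = n ∧ matchLen e ε n ≠ 0)
    with hP
  set s := (Finset.range (n + 1)).filter P with hs
  have hmem : ∀ m : Fin s.card, P (s.orderEmbOfFin rfl m) := fun m =>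
    (Finset.mem_filter.1 (s.orderEmbOfFin_mem rfl m)).2
  have hdis : ∀ b b', P b → P b' → b < b' →
      b < b' - matchLen e ε b' ∧ n - 1 - (b' - matchLen e ε b') < n - 1 - b := by
    intro b b' hb hb' hlt
    have hbb : b' ≤ n := by rcases hb' with h | h <;> omega
    rcases hb with hb | hb
    · have := lt_block_start_of_reset hb.2 hlt
      have h2 := matchLen_le e ε b'
      rcases hb' with h | ⟨rfl, h⟩ <;> omega
    · omega
  have hval : ∀ b j, rev n (blockAt e ε b) j =
      if j < n ∧ b - matchLen e ε b ≤ n - 1 - j ∧ n - 1 - j ≤ b then ε (n - 1 - j) else 0 := by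
    intro b j
    simp only [rev, blockAt]
    split_ifs <;> first | rfl | omega
  refine ⟨s.card, fun m => rev n (blockAt e ε (s.orderEmbOfFin rfl m)),
    fun m => n - 1 - s.orderEmbOfFin rfl m,
    fun m => n - 1 - (s.orderEmbOfFin rfl m - matchLen e ε (s.orderEmbOfFin rfl m)),
    fun m => ?_, fun m m' hne => ?_, ?_⟩
  · have hm := hmem m
    dsimp only
    generalize (s.orderEmbOfFin rfl m : ℕ) = b at hm ⊢
    have hle := matchLen_le e ε b
    have hblock := matchLen_of_mem_block e ε b
    have htop : b ≤ n → ∀ j, n - 1 - b < j ∨ (b = n ∧ matchLen e ε n ≠ 0) →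
        rev n (blockAt e ε b) j = rev (n - 1 - (b - matchLen e ε b) + 1) e j := by
      intro hbn j hj
      rw [hval, rev]
      split_ifs with h1 h2 h2
      · rw [(hblock (n - 1 - j) h1.2.1 (by omega)).2]
        congr 1; omega
      · rcases hj with hj | ⟨rfl, hj⟩ <;> omega
      · exfalso; apply h1; rcases hj with hj | ⟨rfl, hj⟩ <;> refine ⟨?_, ?_, ?_⟩ <;> omega
      · rfl
    rcases hm with ⟨hbn, hb⟩ | ⟨rfl, hb⟩
    · left
      refine ⟨by omega, fun j hj => htop hbn.le j (Or.inl hj), ?_, fun j hj => ?_⟩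
      · rw [hval, if_pos ⟨by omega, by omega, by omega⟩, rev, if_pos (by omega)]
        convert hb using 2 <;> omega
      · rw [hval, if_neg (by omega)]
    · right
      exact ⟨by omega, funext fun j => htop le_rfl j (Or.inr ⟨rfl, hb⟩)⟩
  · have h1 := hmem m
    have h2 := hmem m'
    have h3 : s.orderEmbOfFin rfl m ≠ s.orderEmbOfFin rfl m' := fun h => hne (by simpa using h)
    dsimp only
    generalize (s.orderEmbOfFin rfl m : ℕ) = b at h1 h3 ⊢
    generalize (s.orderEmbOfFin rfl m' : ℕ) = b' at h2 h3 ⊢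
    rw [Set.disjoint_left]
    rintro j ⟨h4, h5⟩ ⟨h6, h7⟩
    rcases lt_or_gt_of_ne h3 with h | h
    · have := (hdis b b' h1 h2 h).2; omega
    · have := (hdis b' b h2 h1 h).2; omega
  · rw [sum_orderEmbOfFin s fun b => rev n (blockAt e ε b)]
    ext j
    rw [Finset.sum_apply]
    by_cases hj : j < n
    · obtain ⟨b, hPb, h1, h2⟩ : ∃ b, P b ∧ b - matchLen e ε b ≤ n - 1 - j ∧ n - 1 - j ≤ b := by
        by_cases hex : ∃ k, n - 1 - j ≤ k ∧ k < n ∧ ε k < e (matchLen e ε k)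
        · obtain ⟨k, h1, h2, h3⟩ := hex
          obtain ⟨b, h4, h5, h6, h7⟩ := exists_block hA h1 h3
          exact ⟨b, Or.inl ⟨by omega, h6⟩, h7, h4⟩
        · push Not at hex
          have h1 := matchLen_of_no_reset hA (show n - 1 - j ≤ n by omega)
            fun i h1 h2 => not_lt.2 (hex i h1 h2)
          exact ⟨n, Or.inr ⟨rfl, by omega⟩, by omega, by omega⟩
      have hbs : b ∈ s := by
        rw [hs, Finset.mem_filter, Finset.mem_range]
        refine ⟨?_, hPb⟩
        rcases hPb with h | h <;> omega
      rw [Finset.sum_eq_single_of_mem b hbs]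
      · rw [hval, if_pos ⟨hj, h1, h2⟩, rev, if_pos hj]
      · intro b' hb' hne
        rw [hs, Finset.mem_filter] at hb'
        rw [hval, if_neg]
        rintro ⟨-, h3, h4⟩
        rcases lt_or_gt_of_ne hne with h | h
        · have := (hdis b' b hb'.2 hPb h).1; omega
        · have := (hdis b b' hPb hb'.2 h).1; omega
    · rw [rev_eq_zero_of_le (not_lt.1 hj)]
      exact (Finset.sum_eq_zero fun b _ => rev_eq_zero_of_le (not_lt.1 hj) _).symm

theorem zero_mem_intCollection (L : List ℕ) : (0 : ℕ → ℕ) ∈ intCollection L :=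
  ⟨0, fun _ => 0, fun _ => 0, fun _ => 0, fun m => m.elim0, fun m => m.elim0, by simp⟩

theorem admits_of_admits_rev_rev {e ε : ℕ → ℕ} (h : ∀ n, Admits e (rev n (rev n ε))) :
    Admits e ε := fun k => by
  have := h (k + 1) k
  rw [rev_rev, if_pos (by omega), matchLen_congr (ε' := ε)] at this
  · exact this
  · intro j hj; rw [rev_rev, if_pos (by omega)]

/-- It suffices to test the inclusion on the truncations of `periodic L`; `Admits.trans` then
carries the result over to all sequences admitted by `L`. -/
theorem admits_of_intCollection_subset {L M : List ℕ} (hM : IsAdmissible M)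
    (h : intCollection L ⊆ intCollection M) : Admits (periodic M) (periodic L) :=
  admits_of_admits_rev_rev fun n => admits_rev_of_mem hM
    (h (rev_mem_intCollection (admits_self _) n)) fun _ hk => rev_eq_zero_of_le hk _

/-! ### The immediate successor -/

theorem rev_injOn {n : ℕ} {μ ν : ℕ → ℕ} (hμ : ∀ k, n ≤ k → μ k = 0) (hν : ∀ k, n ≤ k → ν k = 0)
    (h : rev n μ = rev n ν) : μ = ν := by
  rw [← rev_rev_of_support hμ, h, rev_rev_of_support hν]

theorem eq_or_ascLt_of_not_ascLt {n : ℕ} {μ ν : ℕ → ℕ} (hμ : ∀ k, n ≤ k → μ k = 0)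
    (hν : ∀ k, n ≤ k → ν k = 0) (h : ¬ AscLt ν μ) : μ = ν ∨ AscLt μ ν := by
  rw [ascLt_iff_rev hν hμ, descLt_iff] at h
  rw [ascLt_iff_rev hμ hν]
  exact (toLex_le_iff.1 (not_lt.1 h)).imp_left (rev_injOn hμ hν)

theorem finite_mem_intCollection {L : List ℕ} (hL : IsAdmissible L) (n : ℕ) :
    {τ | τ ∈ intCollection L ∧ ∀ k, n ≤ k → τ k = 0}.Finite := by
  obtain ⟨B, hB⟩ := exists_periodic_le L
  refine (Set.finite_range fun (g : Fin n → Fin (B + 1)) (k : ℕ) =>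
    if h : k < n then (g ⟨k, h⟩ : ℕ) else 0).subset ?_
  rintro τ ⟨hτ, h0⟩
  have hA := admits_rev_of_mem hL hτ h0
  have hb : ∀ k, k < n → τ k < B + 1 := fun k hk => by
    have h1 := (hA (n - 1 - k)).trans (hB _)
    rw [rev_sub hk] at h1
    omega
  refine ⟨fun k => ⟨τ k, hb k k.2⟩, ?_⟩
  ext k
  by_cases h : k < n
  · simp [h]
  · simp [h, h0 k (not_lt.1 h)]

/-- Whatever lies below a sequence supported in `[0, n)` is supported there too, so both extrema are
taken over finite sets. The member `τ₀` ensures that there is a candidate for the successor. -/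
theorem exists_immediateSucc {L : List ℕ} (hL : IsAdmissible L) {n : ℕ} {μ τ₀ : ℕ → ℕ}
    (hμ0 : μ ≠ 0) (hμ : ∀ k, n ≤ k → μ k = 0) (hτ₀ : τ₀ ∈ intCollection L)
    (hτn : ∀ k, n ≤ k → τ₀ k = 0) (hle : toLex (rev n μ) ≤ toLex (rev n τ₀)) :
    ∃ ν c, IsLargestBelow (intCollection L) μ c ∧ IsImmediateSucc (intCollection L) c ν := by
  have hfin := finite_mem_intCollection hL n
  obtain ⟨c, ⟨⟨hcE, hcn⟩, hcμ⟩, hcmax⟩ := Set.exists_max_image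
    ({τ | τ ∈ intCollection L ∧ ∀ k, n ≤ k → τ k = 0} ∩ {τ | AscLt τ μ})
    (fun τ => toLex (rev n τ)) (hfin.inter_of_left _) (by
      refine ⟨0, ⟨zero_mem_intCollection L, fun _ _ => rfl⟩, ?_⟩
      have h0 : ∀ k, n ≤ k → (0 : ℕ → ℕ) k = 0 := fun _ _ => rfl
      rcases eq_or_ascLt_of_not_ascLt h0 hμ (by rintro ⟨k, -, hk⟩; simp at hk) with h | h
      · exact absurd h.symm hμ0
      · exact h)
  have hcτ : AscLt c τ₀ := by
    rw [ascLt_iff_rev hcn hτn]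
    exact lt_of_lt_of_le ((ascLt_iff_rev hcn hμ).1 hcμ) hle
  obtain ⟨ν, ⟨⟨hνE, hνn⟩, hcν⟩, hνmin⟩ := Set.exists_min_image
    ({τ | τ ∈ intCollection L ∧ ∀ k, n ≤ k → τ k = 0} ∩ {τ | AscLt c τ})
    (fun τ => toLex (rev n τ)) (hfin.inter_of_left _) ⟨τ₀, ⟨hτ₀, hτn⟩, hcτ⟩
  refine ⟨ν, c, ⟨hcE, hcμ, fun τ hτ hτμ => ?_⟩, ⟨hνE, hcν, fun τ hτ hτc => ?_⟩⟩
  · have hτn := hτμ.support hμ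
    refine eq_or_ascLt_of_not_ascLt hτn hcn fun h => ?_
    rw [ascLt_iff_rev hcn hτn] at h
    exact absurd h (not_lt.2 (hcmax τ ⟨⟨hτ, hτn⟩, hτμ⟩))
  · obtain ⟨m, hm⟩ := support_of_mem_intCollection hτ
    have h := eq_or_ascLt_of_not_ascLt (n := max m n) (μ := ν) (ν := τ)
      (fun k hk => hνn k (by omega)) (fun k hk => hm k (by omega)) fun h => ?_
    · exact h.imp_left Eq.symm
    · have hτn := h.support hνn
      rw [ascLt_iff_rev hτn hνn] at h
      exact absurd h (not_lt.2 (hνmin τ ⟨⟨hτ, hτn⟩, hτc⟩))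

/-- No member lies strictly between the largest member `c` below `μ` and its successor, so this
successor is the least member that is at least `μ`. -/
theorem bar_spec {L : List ℕ} (hL : IsAdmissible L) {n : ℕ} {μ τ₀ : ℕ → ℕ}
    (hμ0 : μ ≠ 0) (hμ : ∀ k, n ≤ k → μ k = 0) (hτ₀ : τ₀ ∈ intCollection L)
    (hτn : ∀ k, n ≤ k → τ₀ k = 0) (hle : toLex (rev n μ) ≤ toLex (rev n τ₀)) :
    bar L μ ∈ intCollection L ∧ (∀ k, n ≤ k → bar L μ k = 0) ∧
      toLex (rev n μ) ≤ toLex (rev n (bar L μ)) ∧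
      ∀ τ ∈ intCollection L, (∀ k, n ≤ k → τ k = 0) → toLex (rev n μ) ≤ toLex (rev n τ) →
        toLex (rev n (bar L μ)) ≤ toLex (rev n τ) := by
  obtain ⟨c, ⟨hcE, hcμ, hcmax⟩, ⟨hbE, hcb, hbmin⟩⟩ :=
    Classical.epsilon_spec (exists_immediateSucc hL hμ0 hμ hτ₀ hτn hle)
  change bar L μ ∈ _ at hbE
  change AscLt c (bar L μ) at hcb
  change ∀ τ ∈ _, _ → τ = bar L μ ∨ AscLt (bar L μ) τ at hbmin
  have hcn := hcμ.support hμ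
  have hcτ : ∀ τ, (∀ k, n ≤ k → τ k = 0) → toLex (rev n μ) ≤ toLex (rev n τ) → AscLt c τ := by
    intro τ hτ h
    rw [ascLt_iff_rev hcn hτ]
    exact lt_of_lt_of_le ((ascLt_iff_rev hcn hμ).1 hcμ) h
  have hbn : ∀ k, n ≤ k → bar L μ k = 0 := by
    rcases hbmin τ₀ hτ₀ (hcτ _ hτn hle) with h | h
    · rwa [← h]
    · exact h.support hτn
  refine ⟨hbE, hbn, ?_, fun τ hτ hτn h => ?_⟩
  · by_contra! h
    have h1 := hcmax _ hbE ((ascLt_iff_rev hbn hμ).2 h)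
    have h2 : toLex (rev n c) < toLex (rev n (bar L μ)) := (ascLt_iff_rev hcn hbn).1 hcb
    rcases h1 with h1 | h1
    · rw [h1] at h2; exact lt_irrefl _ h2
    · exact lt_asymm h2 ((ascLt_iff_rev hbn hcn).1 h1)
  · rcases hbmin τ hτ (hcτ _ hτn h) with h1 | h1
    · rw [h1]
    · exact le_of_lt ((ascLt_iff_rev hbn hτn).1 h1)

/-- The reversal of `bar L (rev n ε)` is the least admitted word of length `n` that is at least the
word of the first `n` entries of `ε`. -/
theorem rev_bar_rev_spec {L : List ℕ} (hL : IsAdmissible L) {ε : ℕ → ℕ} {n i : ℕ} (hi : i < n)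
    (hεi : ε i ≠ 0) (hle : toLex ε ≤ toLex (periodic L)) :
    Admits (periodic L) (rev n (bar L (rev n ε))) ∧
      toLex (rev n (rev n ε)) ≤ toLex (rev n (bar L (rev n ε))) ∧
      ∀ τ, Admits (periodic L) τ → toLex (rev n (rev n ε)) ≤ toLex (rev n (rev n τ)) →
        toLex (rev n (bar L (rev n ε))) ≤ toLex (rev n (rev n τ)) := by
  -- The reversed truncation of `periodic L` is a member above `rev n ε` because `ε ≤ periodic L`.
  obtain ⟨h1, h2, h3, h4⟩ := bar_spec hL (n := n) (μ := rev n ε) (τ₀ := rev n (periodic L))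
    (fun h => hεi (by rw [← rev_sub hi ε, h]; rfl)) (fun k hk => rev_eq_zero_of_le hk _)
    (rev_mem_intCollection (admits_self _) n) (fun k hk => rev_eq_zero_of_le hk _)
    (toLex_rev_rev_mono hle n)
  exact ⟨admits_rev_of_mem hL h1 h2, h3, fun τ hτ h =>
    h4 _ (rev_mem_intCollection hτ n) (fun k hk => rev_eq_zero_of_le hk _) h⟩

/-! ### Limits -/

theorem eventually_const_of_monotone {u : ℕ → ℕ} {n₀ B : ℕ} (hu : ∀ n, n₀ ≤ n → u n ≤ u (n + 1))
    (hB : ∀ n, n₀ ≤ n → u n ≤ B) : ∃ N, n₀ ≤ N ∧ ∀ n, N ≤ n → u n = u N := by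
  have hmono : ∀ m n, n₀ ≤ m → m ≤ n → u m ≤ u n := by
    intro m n hm hmn
    induction n, hmn using Nat.le_induction with
    | base => exact le_rfl
    | succ n hn ih => exact ih.trans (hu n (by omega))
  have hbdd : BddAbove (u '' Ici n₀) := ⟨B, by rintro _ ⟨n, hn, rfl⟩; exact hB n hn⟩
  obtain ⟨N, hN, hNs⟩ := Nat.sSup_mem (⟨_, n₀, mem_Ici.2 le_rfl, rfl⟩ : (u '' Ici n₀).Nonempty) hbdd
  refine ⟨N, hN, fun n hn => le_antisymm ?_ (hmono N n hN hn)⟩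
  rw [hNs]
  exact le_csSup hbdd ⟨n, le_trans hN hn, rfl⟩

/-- A bounded sequence that increases in the lexicographical order converges entry by entry. -/
theorem exists_tendsto_of_toLex_mono {c : ℕ → ℕ → ℕ} {n₀ B : ℕ}
    (hc : ∀ n, n₀ ≤ n → toLex (c n) ≤ toLex (c (n + 1))) (hB : ∀ n, n₀ ≤ n → ∀ k, c n k ≤ B) :
    ∃ l, Tendsto c atTop (𝓝 l) := by
  have key : ∀ k, ∃ N, n₀ ≤ N ∧ ∀ n, N ≤ n → ∀ j, j < k → c n j = c N j := by
    intro k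
    induction k with
    | zero => exact ⟨n₀, le_rfl, fun _ _ _ h => absurd h (Nat.not_lt_zero _)⟩
    | succ k ih =>
      obtain ⟨N, hN, h⟩ := ih
      obtain ⟨N', hN', h'⟩ := eventually_const_of_monotone (u := fun n => c n k) (n₀ := N) (B := B)
        (fun n hn => by
          -- The entries before `k` are already constant, so a lexicographic increase cannot lower
          -- entry `k`.
          rcases toLex_le_iff.1 (hc n (by omega)) with h1 | ⟨i, hi, hlt⟩
          · exact (congrFun h1 k).le
          · by_cases hik : i < k
            · rw [h n hn i hik, h (n + 1) (by omega) i hik] at hlt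
              exact absurd hlt (lt_irrefl _)
            · rcases (not_lt.1 hik).lt_or_eq with h2 | rfl
              · exact (hi k h2).le
              · exact hlt.le)
        (fun n hn => hB n (by omega) k)
      refine ⟨N', by omega, fun n hn j hj => ?_⟩
      rcases Nat.lt_succ_iff_lt_or_eq.1 hj with h1 | rfl
      · rw [h n (by omega) j h1, h N' hN' j h1]
      · exact h' n hn
  choose N hN hNc using key
  refine ⟨fun k => c (N (k + 1)) k, tendsto_pi_nhds.2 fun k => ?_⟩
  refine tendsto_const_nhds.congr' ?_
  filter_upwards [eventually_ge_atTop (N (k + 1))] with n hn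
  exact (hNc (k + 1) n hn k (by omega)).symm

/-! ### Convergence and fixed points of `revBar`. -/

theorem exists_tendsto_rev_bar {L : List ℕ} (hL : IsAdmissible L) {ε : ℕ → ℕ} (h0 : ε ≠ 0)
    (hle : toLex ε ≤ toLex (periodic L)) :
    ∃ l, Tendsto (fun n => rev n (bar L (rev n ε))) atTop (𝓝 l) := by
  obtain ⟨i, hi⟩ := Function.ne_iff.1 h0
  obtain ⟨B, hB⟩ := exists_periodic_le L
  refine exists_tendsto_of_toLex_mono (n₀ := i + 1) (B := B) (fun n hn => ?_) (fun n hn k => ?_)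
  · obtain ⟨-, -, h3⟩ := rev_bar_rev_spec hL (n := n) (by omega) hi hle
    obtain ⟨h1, h2, -⟩ := rev_bar_rev_spec hL (n := n + 1) (by omega) hi hle
    -- Cut to `n` entries, the word of length `n + 1` competes in the minimum that defines the word
    -- of length `n`, and cutting never increases a word.
    refine (h3 _ h1 ?_).trans (toLex_rev_rev_le _ n)
    have h4 := toLex_rev_rev_mono h2 n
    have h5 : rev n (rev n (rev (n + 1) (rev (n + 1) ε))) = rev n (rev n ε) := by
      ext k; simp only [rev_rev]
      split_ifs <;> first | rfl | omega
    rwa [h5] at h4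
  · obtain ⟨h1, -, -⟩ := rev_bar_rev_spec hL (n := n) (by omega) hi hle
    exact (h1 k).trans (hB _)

theorem maxBlock_zero (L : List ℕ) : maxBlock L 0 = periodic L := by
  ext k; simp [maxBlock]

theorem revBar_of_le {L : List ℕ} {ε : ℕ → ℕ} (h : toLex (periodic L) ≤ toLex ε) :
    revBar L ε = periodic L := by
  rw [revBar, maxBlock_zero, if_pos (toLex_le_iff.1 h)]

theorem tendsto_revBar {L : List ℕ} (hL : IsAdmissible L) {ε : ℕ → ℕ} (h0 : ε ≠ 0)
    (hlt : toLex ε < toLex (periodic L)) :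
    Tendsto (fun n => rev n (bar L (rev n ε))) atTop (𝓝 (revBar L ε)) := by
  rw [revBar, maxBlock_zero, if_neg]
  · exact tendsto_nhds_limUnder (exists_tendsto_rev_bar hL h0 hlt.le)
  · rw [← toLex_le_iff, not_le]; exact hlt

theorem continuous_matchLen (e : ℕ → ℕ) (k : ℕ) : Continuous fun ε => matchLen e ε k := by
  induction k with
  | zero => exact continuous_const
  | succ k ih =>
    exact (continuous_of_discreteTopology
      (f := fun p : ℕ × ℕ => if p.1 = e p.2 then p.2 + 1 else 0)).comp
      ((continuous_apply k).prodMk ih)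

/-- Each state depends on finitely many entries only. Closedness lets admission pass to limits and
makes the set of admitted sequences compact. -/
theorem isClosed_admits (e : ℕ → ℕ) : IsClosed {ε | Admits e ε} := by
  simp only [Admits, ofPred_forall]
  exact isClosed_iInter fun k => isClosed_le (continuous_apply k)
    ((continuous_of_discreteTopology (f := e)).comp (continuous_matchLen e k))

theorem admits_revBar {L : List ℕ} (hL : IsAdmissible L) {ε : ℕ → ℕ} (h0 : ε ≠ 0) :
    Admits (periodic L) (revBar L ε) := by
  rcases le_or_gt (toLex (periodic L)) (toLex ε) with h | h
  · rw [revBar_of_le h]; exact admits_self _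
  · obtain ⟨i, hi⟩ := Function.ne_iff.1 h0
    refine (isClosed_admits _).mem_of_tendsto (tendsto_revBar hL h0 h) ?_
    filter_upwards [eventually_gt_atTop i] with n hn
    exact (rev_bar_rev_spec hL hn hi h.le).1

theorem tendsto_rev_rev (ε : ℕ → ℕ) : Tendsto (fun n => rev n (rev n ε)) atTop (𝓝 ε) := by
  refine tendsto_pi_nhds.2 fun k => tendsto_const_nhds.congr' ?_
  filter_upwards [eventually_gt_atTop k] with n hn
  rw [rev_rev, if_pos hn]

/-- Every truncation of `ε` is already the least admitted word above itself. -/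
theorem revBar_of_admits {L : List ℕ} (hL : IsAdmissible L) {ε : ℕ → ℕ} (h0 : ε ≠ 0)
    (hA : Admits (periodic L) ε) (hR : Recurrent (periodic L) ε) : revBar L ε = ε := by
  have hlt : toLex ε < toLex (periodic L) :=
    lt_of_le_of_ne hA.toLex_le fun h => hR.ne (by simpa using h)
  obtain ⟨i, hi⟩ := Function.ne_iff.1 h0
  refine tendsto_nhds_unique_of_eventuallyEq (tendsto_revBar hL h0 hlt) (tendsto_rev_rev ε) ?_
  filter_upwards [eventually_gt_atTop i] with n hn
  obtain ⟨-, h2, h3⟩ := rev_bar_rev_spec hL hn hi hlt.le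
  exact toLex.injective (le_antisymm (h3 ε hA le_rfl) h2)

/-! ### Evaluation at the powers of a base -/

/-- The sequence `ω, ω², …` -/
def powSeq (ω : ℝ) (k : ℕ) : ℝ := ω ^ (k + 1)

/-- The entries of `e` are the digits of `1` in the base `1 / ω`. -/
structure IsBase (e : ℕ → ℕ) (ω : ℝ) : Prop where
  pos : 0 < ω
  lt_one : ω < 1
  bdd : ∃ B, ∀ k, e k ≤ B
  zero : e 0 ≠ 0
  often : ∀ n, ∃ k, n ≤ k ∧ e k ≠ 0
  eval_eq : eval (powSeq ω) e = 1

theorem summable_powSeq {ω : ℝ} (h0 : 0 < ω) (h1 : ω < 1) : Summable (powSeq ω) := by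
  unfold powSeq
  simp only [pow_succ]
  exact (summable_geometric_of_lt_one h0.le h1).mul_right _

theorem summable_eval {ω : ℝ} (h0 : 0 < ω) (h1 : ω < 1) {ε : ℕ → ℕ} {B : ℕ} (hB : ∀ k, ε k ≤ B) :
    Summable fun k => (ε k : ℝ) * powSeq ω k := by
  refine Summable.of_nonneg_of_le (fun k => ?_) (fun k => ?_)
    ((summable_powSeq h0 h1).mul_left (B : ℝ))
  · unfold powSeq; positivity
  · have : (ε k : ℝ) ≤ B := by exact_mod_cast hB k
    have h2 : 0 ≤ powSeq ω k := by unfold powSeq; positivity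
    exact mul_le_mul_of_nonneg_right this h2

theorem eval_nonneg {ω : ℝ} (h0 : 0 < ω) (ε : ℕ → ℕ) : 0 ≤ eval (powSeq ω) ε :=
  tsum_nonneg fun k => by unfold powSeq; positivity

theorem eval_eq_sum_add {ω : ℝ} (h0 : 0 < ω) (h1 : ω < 1) {ε : ℕ → ℕ} {B : ℕ}
    (hB : ∀ k, ε k ≤ B) (n : ℕ) :
    eval (powSeq ω) ε = ∑ k ∈ Finset.range n, (ε k : ℝ) * powSeq ω k
      + ω ^ n * eval (powSeq ω) fun k => ε (n + k) := by
  unfold eval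
  rw [← (summable_eval h0 h1 hB).sum_add_tsum_nat_add n, ← tsum_mul_left]
  congr 1
  refine tsum_congr fun k => ?_
  rw [Nat.add_comm k n]
  unfold powSeq
  ring

theorem eval_consZero {ω : ℝ} (h0 : 0 < ω) (h1 : ω < 1) {ε : ℕ → ℕ} {B : ℕ}
    (hB : ∀ k, ε k ≤ B) : eval (powSeq ω) (consZero ε) = ω * eval (powSeq ω) ε := by
  rw [eval_eq_sum_add h0 h1 (B := B) (n := 1)]
  · simp [consZero, Nat.add_comm 1]
  · rintro (_ | k)
    · exact Nat.zero_le _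
    · exact hB k

theorem continuousOn_eval {ω : ℝ} (h0 : 0 < ω) (h1 : ω < 1) (B : ℕ) :
    ContinuousOn (eval (powSeq ω)) {ε | ∀ k, ε k ≤ B} := by
  unfold eval
  refine continuousOn_tsum (u := fun k => (B : ℝ) * powSeq ω k) (fun k => ?_)
    ((summable_powSeq h0 h1).mul_left _) (fun k ε hε => ?_)
  · exact (((continuous_of_discreteTopology (f := fun n : ℕ => (n : ℝ))).comp
      (continuous_apply k)).mul continuous_const).continuousOn
  · have h2 : 0 ≤ powSeq ω k := by unfold powSeq; positivity
    rw [norm_mul, Real.norm_of_nonneg h2, Real.norm_of_nonneg (Nat.cast_nonneg _)]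
    exact mul_le_mul_of_nonneg_right (by exact_mod_cast hε k) h2

namespace IsBase

variable {e : ℕ → ℕ} {ω : ℝ}

theorem exists_bound (h : IsBase e ω) : ∃ B, ∀ ε, Admits e ε → ∀ k, ε k ≤ B :=
  let ⟨B, hB⟩ := h.bdd
  ⟨B, fun _ hA k => (hA k).trans (hB _)⟩

end IsBase

/-- The value of the remainder of `e` from entry `i` on. -/
noncomputable def remainder (e : ℕ → ℕ) (ω : ℝ) (i : ℕ) : ℝ := eval (powSeq ω) fun k => e (i + k)

/-- The least upper bound of the values of the admitted sequences with the same first `n` entries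
as `ε`. -/
noncomputable def upper (e : ℕ → ℕ) (ω : ℝ) (ε : ℕ → ℕ) (n : ℕ) : ℝ :=
  ∑ k ∈ Finset.range n, (ε k : ℝ) * powSeq ω k + ω ^ n * remainder e ω (matchLen e ε n)

namespace IsBase

variable {e : ℕ → ℕ} {ω : ℝ}

theorem remainder_zero (h : IsBase e ω) : remainder e ω 0 = 1 := by
  simp only [remainder, Nat.zero_add]; exact h.eval_eq

theorem remainder_succ (h : IsBase e ω) (i : ℕ) :
    remainder e ω i = ω * (e i + remainder e ω (i + 1)) := by
  obtain ⟨B, hB⟩ := h.bdd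
  unfold remainder
  rw [eval_eq_sum_add h.pos h.lt_one (fun k => hB (i + k)) 1]
  simp only [Finset.sum_range_one, powSeq, add_zero, pow_one, zero_add]
  simp only [← Nat.add_assoc]
  ring

theorem remainder_pos (h : IsBase e ω) (i : ℕ) : 0 < remainder e ω i := by
  obtain ⟨B, hB⟩ := h.bdd
  obtain ⟨k, hk, hek⟩ := h.often i
  refine (summable_eval h.pos h.lt_one fun k => hB (i + k)).tsum_pos (fun k => ?_) (k - i) ?_
  · have := h.pos; unfold powSeq; positivity
  · have h1 := h.pos
    rw [show i + (k - i) = k by omega]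
    have : 0 < e k := Nat.pos_of_ne_zero hek
    unfold powSeq; positivity

theorem exists_remainder_le (h : IsBase e ω) : ∃ C, ∀ i, remainder e ω i ≤ C := by
  obtain ⟨B, hB⟩ := h.bdd
  refine ⟨∑' k, (B : ℝ) * powSeq ω k, fun i => ?_⟩
  refine (summable_eval h.pos h.lt_one fun k => hB (i + k)).tsum_le_tsum (fun k => ?_)
    ((summable_powSeq h.pos h.lt_one).mul_left _)
  have h1 := h.pos
  have h2 : 0 ≤ powSeq ω k := by unfold powSeq; positivity
  exact mul_le_mul_of_nonneg_right (by exact_mod_cast hB _) h2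

/-- Continuing a match is what the extremal continuation does anyway, so the bound does not move. -/
theorem upper_succ_of_eq (h : IsBase e ω) {ε : ℕ → ℕ} {n : ℕ} (hn : ε n = e (matchLen e ε n)) :
    upper e ω ε (n + 1) = upper e ω ε n := by
  unfold upper
  rw [matchLen_succ_of_eq hn, Finset.sum_range_succ, h.remainder_succ (matchLen e ε n), ← hn]
  unfold powSeq; ring

theorem upper_succ_of_reset (h : IsBase e ω) {ε : ℕ → ℕ} {n : ℕ} (hn : ε n < e (matchLen e ε n)) :
    upper e ω ε (n + 1) = ∑ k ∈ Finset.range n, (ε k : ℝ) * powSeq ω k + (ε n + 1) * powSeq ω n := by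
  unfold upper
  rw [matchLen_succ_of_lt hn, Finset.sum_range_succ, h.remainder_zero]
  unfold powSeq; ring

/-- After a reset the continuation is worth at most `remainder e ω 0 = 1` unit of the current place.
The missed entry was larger by at least one unit, and the positive remainder behind it is lost as
well. -/
theorem upper_succ_lt (h : IsBase e ω) {ε : ℕ → ℕ} {n : ℕ} (hn : ε n < e (matchLen e ε n)) :
    upper e ω ε (n + 1) < upper e ω ε n := by
  rw [h.upper_succ_of_reset hn, upper, h.remainder_succ]
  have h1 : (ε n : ℝ) + 1 ≤ e (matchLen e ε n) := by exact_mod_cast hn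
  have h2 := h.remainder_pos (matchLen e ε n + 1)
  have h3 : 0 < powSeq ω n := by have := h.pos; unfold powSeq; positivity
  have h4 : ω ^ n * (ω * ((e (matchLen e ε n) : ℝ) + remainder e ω (matchLen e ε n + 1))) =
    ((e (matchLen e ε n) : ℝ) + remainder e ω (matchLen e ε n + 1)) * powSeq ω n := by
    unfold powSeq; ring
  rw [h4]
  have := mul_lt_mul_of_pos_right
    (show (ε n : ℝ) + 1 < e (matchLen e ε n) + remainder e ω (matchLen e ε n + 1) by linarith) h3
  linarith

theorem upper_antitone (h : IsBase e ω) {ε : ℕ → ℕ} (hA : Admits e ε) : Antitone (upper e ω ε) :=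
  antitone_nat_of_succ_le fun n => by
    rcases (hA n).lt_or_eq with hn | hn
    · exact (h.upper_succ_lt hn).le
    · exact (h.upper_succ_of_eq hn).le

theorem tendsto_upper (h : IsBase e ω) {ε : ℕ → ℕ} (hA : Admits e ε) :
    Tendsto (upper e ω ε) atTop (𝓝 (eval (powSeq ω) ε)) := by
  obtain ⟨B, hB⟩ := h.exists_bound
  obtain ⟨C, hC⟩ := h.exists_remainder_le
  rw [← add_zero (eval _ _)]
  refine (summable_eval h.pos h.lt_one (hB ε hA)).hasSum.tendsto_sum_nat.add ?_
  have h1 := (tendsto_pow_atTop_nhds_zero_of_lt_one h.pos.le h.lt_one).mul_const C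
  rw [zero_mul] at h1
  refine squeeze_zero (fun n => ?_) (fun n => ?_) h1
  · exact mul_nonneg (pow_nonneg h.pos.le _) (h.remainder_pos _).le
  · exact mul_le_mul_of_nonneg_left (hC _) (pow_nonneg h.pos.le _)

theorem eval_le_upper (h : IsBase e ω) {ε : ℕ → ℕ} (hA : Admits e ε) (n : ℕ) :
    eval (powSeq ω) ε ≤ upper e ω ε n :=
  (h.upper_antitone hA).le_of_tendsto (h.tendsto_upper hA) n

theorem eval_lt_upper (h : IsBase e ω) {ε : ℕ → ℕ} (hA : Admits e ε) (hR : Recurrent e ε) (n : ℕ) :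
    eval (powSeq ω) ε < upper e ω ε n := by
  obtain ⟨k, hk, hlt⟩ := hR n
  exact (h.eval_le_upper hA (k + 1)).trans_lt
    ((h.upper_succ_lt hlt).trans_le (h.upper_antitone hA hk))

theorem upper_zero (h : IsBase e ω) (ε : ℕ → ℕ) : upper e ω ε 0 = 1 := by
  simp [upper, matchLen, h.remainder_zero]

theorem eval_le_one (h : IsBase e ω) {ε : ℕ → ℕ} (hA : Admits e ε) : eval (powSeq ω) ε ≤ 1 :=
  (h.eval_le_upper hA 0).trans_eq (h.upper_zero ε)

theorem sum_le_eval (h : IsBase e ω) {ε : ℕ → ℕ} (hA : Admits e ε) (n : ℕ) :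
    ∑ k ∈ Finset.range n, (ε k : ℝ) * powSeq ω k ≤ eval (powSeq ω) ε := by
  obtain ⟨B, hB⟩ := h.exists_bound
  rw [eval_eq_sum_add h.pos h.lt_one (hB ε hA) n]
  have := mul_nonneg (pow_nonneg h.pos.le n) (eval_nonneg h.pos fun k => ε (n + k))
  linarith

/-- The comparison of two admitted sequences at the first difference. -/
theorem exists_upper_le_eval (h : IsBase e ω) {ε ε' : ℕ → ℕ} (hA' : Admits e ε')
    (hlt : toLex ε < toLex ε') : ∃ k, upper e ω ε k ≤ eval (powSeq ω) ε' := by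
  obtain ⟨k, hk, hlt⟩ := hlt
  change ∀ j < k, ε j = ε' j at hk
  change ε k < ε' k at hlt
  have hm : matchLen e ε k = matchLen e ε' k := matchLen_congr hk
  have hr : ε k < e (matchLen e ε k) := by rw [hm]; exact hlt.trans_le (hA' k)
  -- At the first difference `ε` resets. The bound just after it is the partial sum with the last
  -- entry raised by one, which `ε'` reaches.
  refine ⟨k + 1, ?_⟩
  rw [h.upper_succ_of_reset hr]
  refine le_trans ?_ (h.sum_le_eval hA' (k + 1))
  rw [Finset.sum_range_succ]
  refine add_le_add (Finset.sum_le_sum fun j hj => ?_) ?_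
  · rw [hk j (Finset.mem_range.1 hj)]
  · refine mul_le_mul_of_nonneg_right (by exact_mod_cast hlt) ?_
    have := h.pos; unfold powSeq; positivity

theorem eval_mono (h : IsBase e ω) {ε ε' : ℕ → ℕ} (hA : Admits e ε) (hA' : Admits e ε')
    (hle : toLex ε ≤ toLex ε') : eval (powSeq ω) ε ≤ eval (powSeq ω) ε' := by
  rcases toLex_le_iff.1 hle with rfl | hlt
  · rfl
  · obtain ⟨k, hk⟩ := h.exists_upper_le_eval hA' hlt
    exact (h.eval_le_upper hA k).trans hk

/-- Recurrence of the smaller sequence excludes a maximal tail, which would have the same value as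
raising the preceding entry by one. -/
theorem eval_lt (h : IsBase e ω) {ε ε' : ℕ → ℕ} (hA : Admits e ε) (hR : Recurrent e ε)
    (hA' : Admits e ε') (hlt : toLex ε < toLex ε') : eval (powSeq ω) ε < eval (powSeq ω) ε' := by
  obtain ⟨k, hk⟩ := h.exists_upper_le_eval hA' hlt
  exact (h.eval_lt_upper hA hR k).trans_le hk

theorem eval_pos (h : IsBase e ω) {ε : ℕ → ℕ} (hA : Admits e ε) (h0 : ε ≠ 0) :
    0 < eval (powSeq ω) ε := by
  obtain ⟨B, hB⟩ := h.exists_bound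
  obtain ⟨i, hi⟩ := Function.ne_iff.1 h0
  refine (summable_eval h.pos h.lt_one (hB ε hA)).tsum_pos (fun k => ?_) i ?_
  · have := h.pos; unfold powSeq; positivity
  · have h1 := h.pos
    have : 0 < ε i := Nat.pos_of_ne_zero hi
    unfold powSeq; positivity

end IsBase

/-! ### Greedy expansions and the bijection onto the unit interval. -/

/-- The states of the greedy expansion of `x`: the current length of the match and the value that
remains to be expanded, rescaled. -/
noncomputable def greedyState (e : ℕ → ℕ) (ω x : ℝ) : ℕ → ℕ × ℝ
  | 0 => (0, x)
  | n + 1 =>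
    let s := greedyState e ω x n
    if ⌊s.2 / ω⌋₊ < e s.1 then (0, s.2 / ω - ⌊s.2 / ω⌋₊) else (s.1 + 1, s.2 / ω - e s.1)

/-- The greedy expansion of `x`. -/
noncomputable def greedy (e : ℕ → ℕ) (ω x : ℝ) (n : ℕ) : ℕ :=
  min ⌊(greedyState e ω x n).2 / ω⌋₊ (e (greedyState e ω x n).1)

namespace IsBase

variable {e : ℕ → ℕ} {ω : ℝ}

/-- The invariant is that the rescaled rest stays strictly below the remainder of `e` at the current
state. After a reset the rest is a fractional part, below `remainder e ω 0 = 1`; after a match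
`remainder_succ` preserves the bound. -/
theorem greedyState_spec (h : IsBase e ω) {x : ℝ} (hx : x ∈ Ico (0 : ℝ) 1) (n : ℕ) :
    (greedyState e ω x n).1 = matchLen e (greedy e ω x) n ∧
      0 ≤ (greedyState e ω x n).2 ∧
      (greedyState e ω x n).2 < remainder e ω (greedyState e ω x n).1 ∧
      x = ∑ k ∈ Finset.range n, (greedy e ω x k : ℝ) * powSeq ω k
        + ω ^ n * (greedyState e ω x n).2 := by
  have hω := h.pos
  induction n with
  | zero => simp [greedyState, matchLen, h.remainder_zero, hx.1, hx.2]
  | succ n ih =>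
    obtain ⟨h1, h2, h3, h4⟩ := ih
    have hg : greedy e ω x n = min ⌊(greedyState e ω x n).2 / ω⌋₊ (e (greedyState e ω x n).1) := rfl
    simp only [greedyState, matchLen, Finset.sum_range_succ]
    rw [← h1]
    generalize greedyState e ω x n = s at *
    have hq : 0 ≤ s.2 / ω := div_nonneg h2 hω.le
    split_ifs with h5 h6 h6
    · rw [hg, min_eq_left h5.le] at h6; omega
    · rw [min_eq_left h5.le] at hg
      refine ⟨rfl, sub_nonneg.2 (Nat.floor_le hq), ?_, ?_⟩
      · rw [h.remainder_zero]
        have := Nat.lt_floor_add_one (s.2 / ω)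
        simp only; linarith
      · rw [hg]
        conv_lhs => rw [h4]
        unfold powSeq
        simp only
        field_simp
        ring
    · rw [min_eq_right (not_lt.1 h5)] at hg
      refine ⟨rfl, ?_, ?_, ?_⟩
      · exact sub_nonneg.2 ((Nat.le_floor_iff hq).1 (not_lt.1 h5))
      · rw [h.remainder_succ] at h3
        have : s.2 / ω < e s.1 + remainder e ω (s.1 + 1) := by
          rw [div_lt_iff₀ hω]; linarith
        simp only; linarith
      · rw [hg]
        conv_lhs => rw [h4]
        unfold powSeq
        simp only
        field_simp
        ring
    · rw [hg, min_eq_right (not_lt.1 h5)] at h6; exact absurd rfl h6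

theorem admits_greedy (h : IsBase e ω) {x : ℝ} (hx : x ∈ Ico (0 : ℝ) 1) :
    Admits e (greedy e ω x) := fun n => by
  rw [← (h.greedyState_spec hx n).1]; exact min_le_right _ _

theorem eval_greedy (h : IsBase e ω) {x : ℝ} (hx : x ∈ Ico (0 : ℝ) 1) :
    eval (powSeq ω) (greedy e ω x) = x := by
  obtain ⟨C, hC⟩ := h.exists_remainder_le
  have hA := h.admits_greedy hx
  refine tendsto_nhds_unique (h.tendsto_upper hA) ?_
  have h1 := ((tendsto_pow_atTop_nhds_zero_of_lt_one h.pos.le h.lt_one).mul_const C)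
  have h2 : Tendsto (fun n => upper e ω (greedy e ω x) n - x) atTop (𝓝 0) := by
    rw [zero_mul] at h1
    refine squeeze_zero (fun n => ?_) (fun n => ?_) h1
    · obtain ⟨h3, -, h5, h6⟩ := h.greedyState_spec hx n
      have := mul_le_mul_of_nonneg_left h5.le (pow_pos h.pos n).le
      unfold upper
      rw [← h3]
      linarith
    · obtain ⟨h3, h4, -, h6⟩ := h.greedyState_spec hx n
      have h7 := mul_nonneg (pow_pos h.pos n).le h4
      have h8 := mul_le_mul_of_nonneg_left (hC (greedyState e ω x n).1) (pow_pos h.pos n).le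
      unfold upper
      rw [← h3]
      linarith
  simpa using h2.add_const x

/-- Without resets from `n` on, `x` would equal its bound `upper` at `n`, against the strict
inequality of the invariant. -/
theorem recurrent_greedy (h : IsBase e ω) {x : ℝ} (hx : x ∈ Ico (0 : ℝ) 1) :
    Recurrent e (greedy e ω x) := by
  have hA := h.admits_greedy hx
  by_contra hR
  unfold Recurrent at hR
  push Not at hR
  obtain ⟨n, hn⟩ := hR
  have hconst : ∀ m, n ≤ m → upper e ω (greedy e ω x) m = upper e ω (greedy e ω x) n := by
    intro m hm
    induction m, hm using Nat.le_induction with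
    | base => rfl
    | succ m hm ih => rw [h.upper_succ_of_eq (le_antisymm (hA m) (hn m hm)), ih]
  have h1 : eval (powSeq ω) (greedy e ω x) = upper e ω (greedy e ω x) n :=
    tendsto_nhds_unique (h.tendsto_upper hA) (tendsto_const_nhds.congr' (by
      filter_upwards [eventually_ge_atTop n] with m hm using (hconst m hm).symm))
  rw [h.eval_greedy hx] at h1
  obtain ⟨h3, h4, h5, h6⟩ := h.greedyState_spec hx n
  have h7 := mul_lt_mul_of_pos_left h5 (pow_pos h.pos n)
  unfold upper at h1
  rw [← h3] at h1
  linarith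

theorem isFundamentalSeq (h : IsBase e ω) :
    IsFundamentalSeq {ε | ε ≠ 0 ∧ Admits e ε ∧ Recurrent e ε} (powSeq ω) := by
  refine ⟨fun n => ⟨pow_pos h.pos _, pow_lt_one₀ h.pos.le h.lt_one (by omega)⟩,
    strictAnti_nat_of_succ_lt fun n => pow_lt_pow_right_of_lt_one₀ h.pos h.lt_one (by omega),
    ?_, ?_, ?_⟩
  · rintro ε ⟨h0, hA, hR⟩
    exact ⟨h.eval_pos hA h0, (h.eval_lt_upper hA hR 0).trans_eq (h.upper_zero ε)⟩
  · rintro ε ⟨-, hA, hR⟩ ε' ⟨-, hA', hR'⟩ heq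
    rcases lt_trichotomy (toLex ε) (toLex ε') with hlt | heq' | hlt
    · exact absurd heq (h.eval_lt hA hR hA' hlt).ne
    · exact toLex.injective heq'
    · exact absurd heq (h.eval_lt hA' hR' hA hlt).ne'
  · intro x hx
    have hx' : x ∈ Ico (0 : ℝ) 1 := ⟨hx.1.le, hx.2⟩
    refine ⟨greedy e ω x, ⟨?_, h.admits_greedy hx', h.recurrent_greedy hx'⟩, h.eval_greedy hx'⟩
    intro h0
    have h1 := h.eval_greedy hx'
    rw [h0] at h1
    simp only [eval, Pi.zero_apply, Nat.cast_zero, zero_mul, tsum_zero] at h1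
    exact hx.1.ne h1

theorem isCompact_admits (h : IsBase e ω) : IsCompact {ε | Admits e ε} := by
  obtain ⟨B, hB⟩ := h.exists_bound
  refine (isCompact_univ_pi fun _ : ℕ => (Set.finite_Iic B).isCompact).of_isClosed_subset
    (isClosed_admits e) fun ε hε k _ => hB ε hε k

end IsBase

/-! ### The zero of the characteristic polynomial is a base. -/

theorem omega_spec {L : List ℕ} (hL : IsAdmissible L) : 0 < omega L ∧ charPoly L (omega L) = 0 :=
  Classical.epsilon_spec (existsUnique_charPoly_zero L hL).exists

/-- As `N ≥ 2`, the terms of `e₁` and of `x ^ N` are distinct; for `x ≥ 1` the former is at least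
`1` and the latter is positive. -/
theorem omega_lt_one {L : List ℕ} (hL : IsAdmissible L) : omega L < 1 := by
  obtain ⟨h0, h1⟩ := omega_spec hL
  by_contra! hc
  obtain ⟨h2, h3⟩ := hL
  have h4 : (L.getD 0 0 : ℝ) * omega L ^ (0 + 1) ≤
      ∑ k ∈ Finset.range (L.length - 1), (L.getD k 0 : ℝ) * omega L ^ (k + 1) :=
    Finset.single_le_sum (f := fun k => (L.getD k 0 : ℝ) * omega L ^ (k + 1))
      (fun k _ => by positivity) (Finset.mem_range.2 (by omega))
  have h5 : (1 : ℝ) ≤ L.getD 0 0 := by exact_mod_cast Nat.one_le_iff_ne_zero.2 h3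
  have h6 : 0 < (1 + (L.getD (L.length - 1) 0 : ℝ)) * omega L ^ L.length := by positivity
  unfold charPoly at h1
  have h7 : (1 : ℝ) ≤ (L.getD 0 0 : ℝ) * omega L ^ (0 + 1) := by
    rw [zero_add, pow_one]; exact one_le_mul_of_one_le_of_one_le h5 hc
  linarith

/-- The characteristic equation says that the first period is worth `1 - ω ^ N`. By periodicity the
value `v` of the whole sequence satisfies `v = 1 - ω ^ N + ω ^ N * v`, so `v = 1`. -/
theorem isBase {L : List ℕ} (hL : IsAdmissible L) : IsBase (periodic L) (omega L) := by
  obtain ⟨h0, h1⟩ := omega_spec hL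
  have hlt := omega_lt_one hL
  have hlen := hL.1
  refine ⟨h0, hlt, exists_periodic_le L, hL.periodic_zero, hL.periodic_mul, ?_⟩
  obtain ⟨B, hB⟩ := exists_periodic_le L
  have h2 := eval_eq_sum_add h0 hlt hB L.length
  have h3 : (fun k => periodic L (L.length + k)) = periodic L := by
    ext k; simp [periodic]
  have h4 : ∑ k ∈ Finset.range L.length, (periodic L k : ℝ) * powSeq (omega L) k =
      1 - omega L ^ L.length := by
    obtain ⟨N, hN⟩ : ∃ N, L.length = N + 1 := ⟨L.length - 1, by omega⟩
    have h5 : ∀ k ∈ Finset.range L.length, (periodic L k : ℝ) * powSeq (omega L) k =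
        (L.getD k 0 : ℝ) * omega L ^ (k + 1) := by
      intro k hk
      rw [periodic, Nat.mod_eq_of_lt (Finset.mem_range.1 hk), powSeq]
    rw [Finset.sum_congr rfl h5]
    unfold charPoly at h1
    rw [hN] at h1 ⊢
    rw [Finset.sum_range_succ]
    simp only [Nat.add_sub_cancel] at h1
    linarith
  rw [h3, h4] at h2
  have h5 : omega L ^ L.length < 1 := pow_lt_one₀ h0.le hlt (by omega)
  have h6 : (1 - omega L ^ L.length) * (eval (powSeq (omega L)) (periodic L) - 1) = 0 := by
    linear_combination h2
  rcases mul_eq_zero.1 h6 with h | h <;> linarith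

/-! ### The evaluation of `revBar` -/

theorem fundSeq_eq (L : List ℕ) : fundSeq L = powSeq (omega L) := rfl

theorem starCollection_eq {L : List ℕ} (hL : IsAdmissible L) :
    starCollection L = {ε | ε ≠ 0 ∧ Admits (periodic L) ε ∧ Recurrent (periodic L) ε} :=
  Set.ext fun _ => mem_starCollection_iff hL

theorem isFundamentalSeq_fundSeq {L : List ℕ} (hL : IsAdmissible L) :
    IsFundamentalSeq (starCollection L) (fundSeq L) := by
  rw [starCollection_eq hL]; exact (isBase hL).isFundamentalSeq

theorem tendsto_eval {e : ℕ → ℕ} {ω : ℝ} (h : IsBase e ω) {c : ℕ → ℕ → ℕ} {l : ℕ → ℕ}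
    (hc : Tendsto c atTop (𝓝 l)) (hA : ∀ᶠ n in atTop, Admits e (c n)) :
    Tendsto (fun n => eval (powSeq ω) (c n)) atTop (𝓝 (eval (powSeq ω) l)) := by
  obtain ⟨B, hB⟩ := h.exists_bound
  have hl := (isClosed_admits e).mem_of_tendsto hc hA
  exact (continuousOn_eval h.pos h.lt_one B l (hB l hl)).tendsto.comp
    (tendsto_nhdsWithin_iff.2 ⟨hc, hA.mono fun n hn => hB _ hn⟩)

/-- For each `n` a larger word has a larger least admitted word above it. Evaluation preserves this
order and is continuous along admitted sequences, so the inequality survives in the limit. -/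
theorem eval_revBar_mono {L : List ℕ} (hL : IsAdmissible L) {ε ε' : ℕ → ℕ} (h0 : ε ≠ 0)
    (h0' : ε' ≠ 0) (hle : toLex ε ≤ toLex ε') :
    eval (fundSeq L) (revBar L ε) ≤ eval (fundSeq L) (revBar L ε') := by
  have hb := isBase hL
  rw [fundSeq_eq]
  rcases le_or_gt (toLex (periodic L)) (toLex ε') with h' | h'
  · rw [revBar_of_le h', hb.eval_eq]
    exact hb.eval_le_one (admits_revBar hL h0)
  have h := hle.trans_lt h'
  obtain ⟨i, hi⟩ := Function.ne_iff.1 h0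
  obtain ⟨i', hi'⟩ := Function.ne_iff.1 h0'
  have key : ∀ᶠ n in atTop, Admits (periodic L) (rev n (bar L (rev n ε))) ∧
      Admits (periodic L) (rev n (bar L (rev n ε'))) ∧
      toLex (rev n (bar L (rev n ε))) ≤ toLex (rev n (bar L (rev n ε'))) := by
    filter_upwards [eventually_gt_atTop i, eventually_gt_atTop i'] with n hn hn'
    obtain ⟨h1, h2, h3⟩ := rev_bar_rev_spec hL hn hi h.le
    obtain ⟨h1', h2', h3'⟩ := rev_bar_rev_spec hL hn' hi' h'.le
    have h4 : rev n (rev n (rev n (bar L (rev n ε')))) = rev n (bar L (rev n ε')) :=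
      rev_rev_of_support fun k hk => rev_eq_zero_of_le hk _
    have h5 := h3 _ h1'
    rw [h4] at h5
    exact ⟨h1, h1', h5 ((toLex_rev_rev_mono hle n).trans h2')⟩
  refine le_of_tendsto_of_tendsto
    (tendsto_eval hb (tendsto_revBar hL h0 h) (key.mono fun n hn => hn.1))
    (tendsto_eval hb (tendsto_revBar hL h0' h') (key.mono fun n hn => hn.2.1))
    (key.mono fun n hn => hb.eval_mono hn.1 hn.2.1 hn.2.2)

/-! ### The numerator: monotonicity and attained values. -/

theorem expansion_spec {M : List ℕ} (hM : IsAdmissible M) {x : ℝ} (hx : x ∈ Ioo (0 : ℝ) 1) :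
    expansion M x ∈ starCollection M ∧ eval (fundSeq M) (expansion M x) = x :=
  Classical.epsilon_spec ((isFundamentalSeq_fundSeq hM).2.2.surjOn hx)

theorem expansion_eval {M : List ℕ} (hM : IsAdmissible M) {ε : ℕ → ℕ} (hε : ε ∈ starCollection M) :
    expansion M (eval (fundSeq M) ε) = ε := by
  have hf := (isFundamentalSeq_fundSeq hM).2.2
  obtain ⟨h1, h2⟩ := expansion_spec hM (hf.mapsTo hε)
  exact hf.injOn h1 hε h2

/-- The numerator of the fluctuation function, extended to `(0, 1)`. -/
noncomputable def numerator (L M : List ℕ) (x : ℝ) : ℝ :=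
  eval (fundSeq L) (revBar L (expansion M x))

theorem numerator_monotoneOn {L M : List ℕ} (hL : IsAdmissible L) (hM : IsAdmissible M) :
    MonotoneOn (numerator L M) (Ioo 0 1) := by
  intro x hx y hy hxy
  obtain ⟨h1, h2⟩ := expansion_spec hM hx
  obtain ⟨h3, h4⟩ := expansion_spec hM hy
  rw [mem_starCollection_iff hM] at h1 h3
  refine eval_revBar_mono hL h1.1 h3.1 ?_
  by_contra! hlt
  have := (isBase hM).eval_lt h3.2.1 h3.2.2 h1.2.1 hlt
  rw [← fundSeq_eq, h2, h4] at this
  exact absurd hxy (not_le.2 this)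

theorem numerator_le_one {L M : List ℕ} (hL : IsAdmissible L) (hM : IsAdmissible M) {x : ℝ}
    (hx : x ∈ Ioo (0 : ℝ) 1) : numerator L M x ≤ 1 :=
  (isBase hL).eval_le_one
    (admits_revBar hL ((mem_starCollection_iff hM).1 (expansion_spec hM hx).1).1)

theorem numerator_nonneg {L : List ℕ} (hL : IsAdmissible L) (M : List ℕ) (x : ℝ) :
    0 ≤ numerator L M x := eval_nonneg (isBase hL).pos _

theorem starCollection_subset {L M : List ℕ} (hL : IsAdmissible L) (hM : IsAdmissible M)
    (hLM : intCollection L ⊆ intCollection M) : starCollection L ⊆ starCollection M := by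
  have hef := admits_of_intCollection_subset hM hLM
  intro ε hε
  rw [mem_starCollection_iff hL] at hε
  rw [mem_starCollection_iff hM]
  exact ⟨hε.1, hef.trans hε.2.1, hε.2.2.trans hef hε.2.1⟩

/-- On the smaller collection the numerator merely changes the base of evaluation; all control over
its values comes from here. -/
theorem numerator_eval {L M : List ℕ} (hL : IsAdmissible L) (hM : IsAdmissible M)
    (hLM : intCollection L ⊆ intCollection M) {ε : ℕ → ℕ} (hε : ε ∈ starCollection L) :
    numerator L M (eval (fundSeq M) ε) = eval (fundSeq L) ε := by
  rw [numerator, expansion_eval hM (starCollection_subset hL hM hLM hε)]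
  obtain ⟨h0, hA, hR⟩ := (mem_starCollection_iff hL).1 hε
  rw [revBar_of_admits hL h0 hA hR]

/-- Every value in `(0, 1)` is taken at the value of a member of the smaller collection. -/
theorem exists_numerator_eq {L M : List ℕ} (hL : IsAdmissible L) (hM : IsAdmissible M)
    (hLM : intCollection L ⊆ intCollection M) {t : ℝ} (ht : t ∈ Ioo (0 : ℝ) 1) :
    ∃ ε ∈ starCollection L, eval (fundSeq L) ε = t ∧ eval (fundSeq M) ε ∈ Ioo (0 : ℝ) 1 ∧
      numerator L M (eval (fundSeq M) ε) = t := by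
  obtain ⟨ε, hε, rfl⟩ := (isFundamentalSeq_fundSeq hL).2.2.surjOn ht
  exact ⟨ε, hε, rfl, (isFundamentalSeq_fundSeq hM).2.2.mapsTo (starCollection_subset hL hM hLM hε),
    numerator_eval hL hM hLM hε⟩

/-- A value strictly between those at `a` and `b` is taken between `a` and `b`. -/
theorem exists_mem_Ioo_numerator_eq {L M : List ℕ} (hL : IsAdmissible L) (hM : IsAdmissible M)
    (hLM : intCollection L ⊆ intCollection M) {a b : ℝ} (ha : a ∈ Ioo (0 : ℝ) 1)
    (hb : b ∈ Ioo (0 : ℝ) 1) {t : ℝ} (h1 : numerator L M a < t) (h2 : t < numerator L M b) :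
    ∃ ε ∈ starCollection L, eval (fundSeq M) ε ∈ Ioo a b ∧
      numerator L M (eval (fundSeq M) ε) = t := by
  obtain ⟨ε, hε, -, h3, h4⟩ := exists_numerator_eq hL hM hLM
    ⟨(numerator_nonneg hL M a).trans_lt h1, h2.trans_le (numerator_le_one hL hM hb)⟩
  have hmono := numerator_monotoneOn hL hM
  refine ⟨ε, hε, ⟨?_, ?_⟩, h4⟩
  · by_contra! hc
    have := hmono h3 ha hc
    linarith
  · by_contra! hc
    have := hmono hb h3 hc
    linarith

/-! ### Scaling -/

theorem consZero_mem_starCollection {L : List ℕ} (hL : IsAdmissible L) {ε : ℕ → ℕ}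
    (hε : ε ∈ starCollection L) : consZero ε ∈ starCollection L := by
  rw [mem_starCollection_iff hL] at hε ⊢
  have he := hL.periodic_zero
  refine ⟨fun h => hε.1 (funext fun k => congrFun h (k + 1)), (admits_consZero_iff he ε).2 hε.2.1,
    hε.2.2.consZero he⟩

theorem eval_fundSeq_consZero {L M : List ℕ} (hL : IsAdmissible L) (hM : IsAdmissible M)
    {ε : ℕ → ℕ} (hε : ε ∈ starCollection L) :
    eval (fundSeq M) (consZero ε) = omega M * eval (fundSeq M) ε := by
  obtain ⟨B, hB⟩ := (isBase hL).exists_bound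
  exact eval_consZero (isBase hM).pos (isBase hM).lt_one
    (hB ε ((mem_starCollection_iff hL).1 hε).2.1)

theorem single_mem_starCollection {L : List ℕ} (hL : IsAdmissible L) :
    Pi.single 0 1 ∈ starCollection L := by
  rw [mem_starCollection_iff hL]
  have hA : Admits (periodic L) (Pi.single 0 1) := by
    rintro (_ | k)
    · have := hL.periodic_zero
      simp only [matchLen, Pi.single_eq_same]; omega
    · simp
  refine ⟨fun h => ?_, hA, recurrent_of_eventually_zero hL.periodic_mul hA (n := 1) ?_⟩
  · have := congrFun h 0
    simp at this
  · intro k hk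
    rw [Pi.single_eq_of_ne (by omega)]

theorem eval_single (L : List ℕ) : eval (fundSeq L) (Pi.single 0 1) = omega L := by
  unfold eval
  rw [tsum_eq_single 0]
  · simp [fundSeq]
  · intro k hk
    simp [Pi.single_eq_of_ne hk]

theorem omega_mul_mem {M : List ℕ} (hM : IsAdmissible M) {x : ℝ} (hx : x ∈ Ioo (0 : ℝ) 1) :
    omega M * x ∈ Ioo (0 : ℝ) 1 :=
  ⟨mul_pos (isBase hM).pos hx.1,
    mul_lt_one_of_nonneg_of_lt_one_left (isBase hM).pos.le (isBase hM).lt_one hx.2.le⟩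

theorem numerator_omega {L M : List ℕ} (hL : IsAdmissible L) (hM : IsAdmissible M)
    (hLM : intCollection L ⊆ intCollection M) : numerator L M (omega M) = omega L := by
  rw [← eval_single M, numerator_eval hL hM hLM (single_mem_starCollection hL), eval_single]

/-- On the smaller collection the identity is the prefixing of a zero. Its members realise every
value in `(0, 1)`, so monotonicity forces the identity at all other points. -/
theorem numerator_omega_mul {L M : List ℕ} (hL : IsAdmissible L) (hM : IsAdmissible M)
    (hLM : intCollection L ⊆ intCollection M) {x : ℝ} (hx : x ∈ Ioo (0 : ℝ) 1) :
    numerator L M (omega M * x) = omega L * numerator L M x := by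
  have hmono := numerator_monotoneOn hL hM (L := L) (M := M)
  have hbL := isBase hL
  have hbM := isBase hM
  have hshift : ∀ ε ∈ starCollection L, numerator L M (omega M * eval (fundSeq M) ε) =
      omega L * eval (fundSeq L) ε := fun ε hε => by
    rw [← eval_fundSeq_consZero hL hM hε, numerator_eval hL hM hLM
      (consZero_mem_starCollection hL hε), eval_fundSeq_consZero hL hL hε]
  have hle : numerator L M (omega M * x) ≤ omega L := by
    rw [← numerator_omega hL hM hLM]
    exact hmono (omega_mul_mem hM hx) ⟨hbM.pos, hbM.lt_one⟩
      (mul_le_of_le_one_right hbM.pos.le hx.2.le)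
  refine le_antisymm ?_ ?_
  · by_contra! hlt
    -- A value `t` in the supposed gap is taken at a member of the smaller collection. Comparing
    -- that point with `x`, before scaling on one side and after scaling on the other, gives a
    -- contradiction.
    obtain ⟨t, h1, h2⟩ := exists_between ((lt_div_iff₀' hbL.pos).2 hlt)
    have h3 : t < 1 := h2.trans_le ((div_le_one hbL.pos).2 hle)
    obtain ⟨ε, hε, h4, h5, h6⟩ := exists_numerator_eq hL hM hLM
      ⟨(numerator_nonneg hL M x).trans_lt h1, h3⟩
    have h7 := hshift ε hε
    rw [h4] at h7
    rw [lt_div_iff₀' hbL.pos] at h2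
    rcases le_total (eval (fundSeq M) ε) x with h | h
    · have := hmono h5 hx h
      linarith
    · have := hmono (omega_mul_mem hM hx) (omega_mul_mem hM h5)
        (mul_le_mul_of_nonneg_left h hbM.pos.le)
      linarith
  · by_contra! hlt
    obtain ⟨t, h1, h2⟩ := exists_between ((div_lt_iff₀' hbL.pos).2 hlt)
    have h3 : 0 < t := (div_nonneg (numerator_nonneg hL M _) hbL.pos.le).trans_lt h1
    obtain ⟨ε, hε, h4, h5, h6⟩ := exists_numerator_eq hL hM hLM
      ⟨h3, h2.trans_le (numerator_le_one hL hM hx)⟩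
    have h7 := hshift ε hε
    rw [h4] at h7
    rw [div_lt_iff₀' hbL.pos] at h1
    rcases le_total x (eval (fundSeq M) ε) with h | h
    · have := hmono hx h5 h
      linarith
    · have := hmono (omega_mul_mem hM h5) (omega_mul_mem hM hx)
        (mul_le_mul_of_nonneg_left h hbM.pos.le)
      linarith

theorem numerator_omega_pow_mul {L M : List ℕ} (hL : IsAdmissible L) (hM : IsAdmissible M)
    (hLM : intCollection L ⊆ intCollection M) {x : ℝ} (hx : x ∈ Ioo (0 : ℝ) 1) (n : ℕ) :
    omega M ^ n * x ∈ Ioo (0 : ℝ) 1 ∧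
      numerator L M (omega M ^ n * x) = omega L ^ n * numerator L M x := by
  induction n with
  | zero => simpa using hx
  | succ n ih =>
    rw [pow_succ', pow_succ', mul_assoc, mul_assoc, ← ih.2]
    exact ⟨omega_mul_mem hM ih.1, numerator_omega_mul hL hM hLM ih.1⟩

theorem exists_omega_pow_le {ω y : ℝ} (h0 : 0 ≤ ω) (h1 : ω < 1) (hy : y ∈ Ioo (0 : ℝ) 1) :
    ∃ n : ℕ, ω ^ (n + 1) ≤ y ∧ y < ω ^ n := by
  classical
  have hex : ∃ n : ℕ, ω ^ (n + 1) ≤ y := by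
    obtain ⟨n, hn⟩ := exists_pow_lt_of_lt_one hy.1 h1
    exact ⟨n, (pow_le_pow_of_le_one h0 h1.le (Nat.le_succ n)).trans hn.le⟩
  refine ⟨Nat.find hex, Nat.find_spec hex, ?_⟩
  rcases Nat.eq_zero_or_pos (Nat.find hex) with h | h
  · rw [h, pow_zero]; exact hy.2
  · have := Nat.find_min hex (show Nat.find hex - 1 < Nat.find hex by omega)
    rw [Nat.sub_add_cancel h] at this
    exact not_le.1 this

theorem gamma_pos {L M : List ℕ} (hL : IsAdmissible L) (hM : IsAdmissible M) : 0 < gamma L M :=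
  Real.logb_pos ((one_lt_inv₀ (isBase hM).pos).2 (isBase hM).lt_one)
    ((one_lt_inv₀ (isBase hL).pos).2 (isBase hL).lt_one)

theorem omega_rpow_gamma {L M : List ℕ} (hL : IsAdmissible L) (hM : IsAdmissible M) :
    omega M ^ gamma L M = omega L := by
  have hL0 := (isBase hL).pos
  have hM0 := (isBase hM).pos
  have h := Real.rpow_logb (inv_pos.2 hM0) (inv_ne_one.2 (isBase hM).lt_one.ne) (inv_pos.2 hL0)
  rw [Real.inv_rpow hM0.le] at h
  exact inv_injective h

/-- Since `ω(M) ^ γ = ω(L)`, numerator and denominator pick up the same factor under scaling, and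
the choice of `n` drops out. -/
theorem delta_eq {L M : List ℕ} (hL : IsAdmissible L) (hM : IsAdmissible M)
    (hLM : intCollection L ⊆ intCollection M) {y : ℝ} (hy : y ∈ Ioo (0 : ℝ) 1) :
    delta L M y = numerator L M y / y ^ gamma L M := by
  have hM0 := (isBase hM).pos
  have hL0 := (isBase hL).pos
  have hn := Classical.epsilon_spec (exists_omega_pow_le hM0.le (isBase hM).lt_one hy)
  unfold delta
  set n := Classical.epsilon fun n : ℕ => omega M ^ (n + 1) ≤ y ∧ y < omega M ^ n
  have hp := pow_pos hM0 n
  have hx : y / omega M ^ n ∈ Ioo (0 : ℝ) 1 := ⟨div_pos hy.1 hp, (div_lt_one hp).2 hn.2⟩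
  have h1 := (numerator_omega_pow_mul hL hM hLM hx n).2
  rw [mul_div_cancel₀ _ hp.ne'] at h1
  change numerator L M _ / _ = _
  rw [h1, Real.div_rpow hy.1.le hp.le, ← Real.rpow_pow_comm hM0.le, omega_rpow_gamma hL hM]
  have := pow_pos hL0 n
  have := Real.rpow_pos_of_pos hy.1 (gamma L M)
  field_simp

/-! ### Continuity and local constancy of the numerator. -/

theorem numerator_pos {L M : List ℕ} (hL : IsAdmissible L) (hM : IsAdmissible M)
    (hLM : intCollection L ⊆ intCollection M) {x : ℝ} (hx : x ∈ Ioo (0 : ℝ) 1) :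
    0 < numerator L M x := by
  have hbM := isBase hM
  obtain ⟨n, hn, -⟩ := exists_omega_pow_le hbM.pos.le hbM.lt_one hx
  obtain ⟨h1, h2⟩ := numerator_omega_pow_mul hL hM hLM ⟨hbM.pos, hbM.lt_one⟩ n
  rw [numerator_omega hL hM hLM] at h2
  rw [← pow_succ] at h1 h2
  refine lt_of_lt_of_le ?_ (numerator_monotoneOn hL hM h1 hx hn)
  rw [h2]
  exact mul_pos (pow_pos (isBase hL).pos n) (isBase hL).pos

/-- A jump of a monotone function would skip values, but every value in `(0, 1)` is taken. -/
theorem numerator_continuousOn {L M : List ℕ} (hL : IsAdmissible L) (hM : IsAdmissible M)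
    (hLM : intCollection L ⊆ intCollection M) : ContinuousOn (numerator L M) (Ioo 0 1) := by
  have hmono := numerator_monotoneOn hL hM (L := L) (M := M)
  intro x hx
  refine ContinuousAt.continuousWithinAt ?_
  have hpos := numerator_pos hL hM hLM hx
  have hle := numerator_le_one hL hM hx (L := L)
  have hnhds : Ioo (0 : ℝ) 1 ∈ 𝓝 x := Ioo_mem_nhds hx.1 hx.2
  rw [Metric.continuousAt_iff']
  intro δ hδ
  have hleft : ∀ᶠ y in 𝓝 x, numerator L M x - δ < numerator L M y := by
    obtain ⟨ε, -, -, h2, h3⟩ := exists_numerator_eq hL hM hLM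
      -- The maximum with half the value keeps `t` positive, hence attained.
      (t := max (numerator L M x - δ / 2) (numerator L M x / 2))
      ⟨lt_max_of_lt_right (by linarith), max_lt (by linarith) (by linarith)⟩
    have hlt : eval (fundSeq M) ε < x := by
      by_contra! hge
      have h4 := hmono hx h2 hge
      have : max (numerator L M x - δ / 2) (numerator L M x / 2) < numerator L M x :=
        max_lt (by linarith) (by linarith)
      linarith
    filter_upwards [Ioo_mem_nhds hlt hx.2] with y hy
    have h4 := hmono h2 ⟨h2.1.trans hy.1, hy.2⟩ hy.1.le
    have := le_max_left (numerator L M x - δ / 2) (numerator L M x / 2)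
    linarith
  have hright : ∀ᶠ y in 𝓝 x, numerator L M y < numerator L M x + δ := by
    -- The numerator equals `1` wherever `revBar` is the maximal block; there the upper estimate is
    -- trivial.
    by_cases hc : numerator L M x < 1
    · obtain ⟨ε, -, -, h2, h3⟩ := exists_numerator_eq hL hM hLM
        (t := min (numerator L M x + δ / 2) ((numerator L M x + 1) / 2))
        ⟨lt_min (by linarith) (by linarith),
          (min_le_right _ _).trans_lt (by linarith)⟩
      have hlt : x < eval (fundSeq M) ε := by
        by_contra! hge
        have h4 := hmono h2 hx hge
        have : numerator L M x < min (numerator L M x + δ / 2) ((numerator L M x + 1) / 2) :=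
          lt_min (by linarith) (by linarith)
        linarith
      filter_upwards [Ioo_mem_nhds hx.1 hlt] with y hy
      have h4 := hmono ⟨hy.1, hy.2.trans h2.2⟩ h2 hy.2.le
      have := min_le_left (numerator L M x + δ / 2) ((numerator L M x + 1) / 2)
      linarith
    · filter_upwards [hnhds] with y hy
      linarith [numerator_le_one hL hM hy]
  filter_upwards [hleft, hright] with y h1 h2
  rw [Real.dist_eq, abs_lt]
  constructor <;> linarith

theorem delta_continuousOn {L M : List ℕ} (hL : IsAdmissible L) (hM : IsAdmissible M)
    (hLM : intCollection L ⊆ intCollection M) : ContinuousOn (delta L M) (Ioo 0 1) := by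
  refine ContinuousOn.congr (f := fun y => numerator L M y / y ^ gamma L M) ?_
    fun y hy => delta_eq hL hM hLM hy
  refine (numerator_continuousOn hL hM hLM).div (fun y hy => ?_) fun y hy => ?_
  · exact (Real.continuousAt_rpow_const y _ (Or.inl hy.1.ne')).continuousWithinAt
  · exact (Real.rpow_pos_of_pos hy.1 _).ne'

/-- Near a point of `U` that is not exceptional, the numerator is constant. -/
theorem exists_nhds_numerator_const {L M : List ℕ} (hL : IsAdmissible L) (hM : IsAdmissible M)
    (hLM : intCollection L ⊆ intCollection M) {x : ℝ} (hx : x ∈ regularSet L M)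
    (hx' : x ∉ exceptionalSet L M) :
    x ∈ Ioo (0 : ℝ) 1 ∧ ∃ a b, x ∈ Ioo a b ∧ Ioo a b ⊆ Ioo 0 1 ∧
      ∀ y ∈ Ioo a b, numerator L M y = numerator L M x := by
  have hf := (isFundamentalSeq_fundSeq hM).2.2
  have hbL := isBase hL
  obtain ⟨ε, ⟨hε, hεL⟩, rfl⟩ := hx
  have hx01 := hf.mapsTo hε
  refine ⟨hx01, ?_⟩
  set W := eval (fundSeq M) '' {ν | Admits (periodic L) ν} with hW
  have hWc : IsClosed W := by
    obtain ⟨B, hB⟩ := hbL.exists_bound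
    refine (hbL.isCompact_admits.image_of_continuousOn ?_).isClosed
    exact (continuousOn_eval (isBase hM).pos (isBase hM).lt_one B).mono fun ν hν => hB ν hν
  have hxW : eval (fundSeq M) ε ∉ W := by
    -- If `ν` is in the larger collection, uniqueness of expansions gives `ν = ε`, which is outside
    -- the closure; if not, the point is exceptional.
    rintro ⟨ν, hν, heq⟩
    have hν0 : ν ≠ 0 := by
      rintro rfl
      simp only [eval, Pi.zero_apply, Nat.cast_zero, zero_mul, tsum_zero] at heq
      exact hx01.1.ne heq
    have hνL := mem_starClosure_of_admits hL hν0 hν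
    by_cases hνM : ν ∈ starCollection M
    · rw [← hf.injOn hνM hε heq] at hεL
      exact hεL hνL
    · exact hx' ⟨ν, ⟨hνL, hνM⟩, heq⟩
  have hnhds : Wᶜ ∩ Ioo 0 1 ∈ 𝓝 (eval (fundSeq M) ε) :=
    inter_mem (hWc.isOpen_compl.mem_nhds hxW) (Ioo_mem_nhds hx01.1 hx01.2)
  obtain ⟨a, b, hab, hsub⟩ := mem_nhds_iff_exists_Ioo_subset.1 hnhds
  refine ⟨a, b, hab, fun y hy => (hsub hy).2, ?_⟩
  -- The order of `y` and `z` is left open, so that exchanging them yields equality.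
  have key : ∀ y ∈ Ioo a b, ∀ z ∈ Ioo a b, numerator L M y ≤ numerator L M z := by
    intro y hy z hz
    by_contra! hlt
    obtain ⟨t, h1, h2⟩ := exists_between hlt
    obtain ⟨ν, hν, h3, -⟩ :=
      exists_mem_Ioo_numerator_eq hL hM hLM (hsub hz).2 (hsub hy).2 h1 h2
    exact (hsub (show eval (fundSeq M) ν ∈ Ioo a b from
      ⟨hz.1.trans h3.1, h3.2.trans hy.2⟩)).1 ⟨ν, ((mem_starCollection_iff hL).1 hν).2.1, rfl⟩
  exact fun y hy => le_antisymm (key y hy _ hab) (key _ hab y hy)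

end GenZeck

theorem mainTheorem3 (L M : List ℕ)
    (hL : GenZeck.IsAdmissible L) (hM : GenZeck.IsAdmissible M)
    (hLM : GenZeck.intCollection L ⊂ GenZeck.intCollection M) :
    -- the objects that define the fluctuation function are well defined
    (GenZeck.IsFundamentalSeq (GenZeck.starCollection L) (GenZeck.fundSeq L) ∧
      GenZeck.IsFundamentalSeq (GenZeck.starCollection M) (GenZeck.fundSeq M) ∧
      ∀ ε ∈ GenZeck.starCollection M, GenZeck.DescLt ε (GenZeck.maxBlock L 0) →
        Tendsto (fun n => GenZeck.rev n (GenZeck.bar L (GenZeck.rev n ε))) atTop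
          (𝓝 (GenZeck.revBar L ε))) ∧
    -- continuity
    ContinuousOn (GenZeck.delta L M) (Ioo 0 1) ∧
    -- the behaviour on `U`
    ∀ x ∈ GenZeck.regularSet L M, x ∉ GenZeck.exceptionalSet L M →
      (∃ V ∈ 𝓝 x, StrictAntiOn (GenZeck.delta L M) V) ∧
        DifferentiableAt ℝ (GenZeck.delta L M) x := by
  have hLM' := hLM.subset
  refine ⟨⟨GenZeck.isFundamentalSeq_fundSeq hL, GenZeck.isFundamentalSeq_fundSeq hM,
    fun ε hε hlt => GenZeck.tendsto_revBar hL hε.1 (by rwa [GenZeck.maxBlock_zero] at hlt)⟩,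
    GenZeck.delta_continuousOn hL hM hLM', fun x hx hx' => ?_⟩
  obtain ⟨hx01, a, b, hab, hsub, hconst⟩ :=
    GenZeck.exists_nhds_numerator_const hL hM hLM' hx hx'
  have hpos := GenZeck.numerator_pos hL hM hLM' hx01
  have hγ := GenZeck.gamma_pos hL hM
  -- Local constancy of the numerator leaves only the power of `y`, from which both monotonicity and
  -- differentiability are read off.
  have hδ : ∀ y ∈ Ioo a b, GenZeck.delta L M y =
      GenZeck.numerator L M x / y ^ GenZeck.gamma L M := fun y hy => by
    rw [GenZeck.delta_eq hL hM hLM' (hsub hy), hconst y hy]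
  have hnhds : Ioo a b ∈ 𝓝 x := Ioo_mem_nhds hab.1 hab.2
  refine ⟨⟨Ioo a b, hnhds, fun y hy z hz hyz => ?_⟩, ?_⟩
  · rw [hδ y hy, hδ z hz]
    exact div_lt_div_of_pos_left hpos (Real.rpow_pos_of_pos (hsub hy).1 _)
      (Real.rpow_lt_rpow (hsub hy).1.le hyz hγ)
  · have h1 : DifferentiableAt ℝ
        (fun y : ℝ => GenZeck.numerator L M x / y ^ GenZeck.gamma L M) x :=
      (differentiableAt_const _).div (Real.differentiableAt_rpow_const_of_ne _ hx01.1.ne')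
        (Real.rpow_pos_of_pos hx01.1 _).ne'
    exact h1.congr_of_eventuallyEq (by filter_upwards [hnhds] with y hy using hδ y hy)
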